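/- Let $m\in\mathbb Z_{\ge 0}$ and write $q=e^{2\pi i\tau}$, $q^x=e^{2\pi i\tau x}$, $\operatorname{Im}\tau>0$. Put $$\Phi_1^{[B;m]}(\tau,z_1,z_2,t)=e^{2\pi i(m+\frac12)t}\sum_{j\in\mathbb Z}(-1)^j\frac{e^{\pi i j(2m+1)(z_1+z_2)+\pi i z_1}\,q^{(m+\frac12)j^2+\frac j2}}{1-e^{2\pi i z_1}q^j},$$ $$\Phi^{[B;m]}(\tau,z_1,z_2,t)=\Phi_1^{[B;m]}(\tau,z_1,z_2,t)-\Phi_1^{[B;m]}(\tau,z_2,z_1,t),$$ $$\Theta^-_{j,d}(\tau,z)=\sum_{n\in\mathbb Z}(-1)^n e^{2\pi i d z(n+\frac{j}{2d})}q^{d(n+\frac{j}{2d})^2},\qquad E(x)=2\int_0^x e^{-\pi u^2}\,du,$$ $$R^{[B]}_{j+\frac12,m+\frac12}(\tau,v)=\sum_{n\in \frac12+\mathbb Z,\ n\equiv j+\frac12\ (2m+1)}(-1)^{n-(j+\frac12)}\Big\{\operatorname{sgn}(n)-E\Big(\big(n+(2m+1)\tfrac{\operatorname{Im}v}{\operatorname{Im}\tau}\big)\sqrt{\tfrac{\operatorname{Im}\tau}{m+1/2}}\Big)\Big\}e^{-\frac{\pi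 i n^2\tau}{2m+1}-2\pi i n v},$$ and let $\widetilde\Phi^{[B;m]}=\Phi^{[B;m]}+\Phi^{[B;m]}_{\mathrm{add}}$, where $$\Phi^{[B;m]}_{\mathrm{add}}(\tau,z_1,z_2,t)=\tfrac12 e^{2\pi i(m+\frac12)t}\sum_{j=0}^{2m}R^{[B]}_{j+\frac12,m+\frac12}\big(\tau,\tfrac{z_1-z_2}{2}\big)\big(\Theta^-_{j+\frac12,m+\frac12}+\Theta^-_{-(j+\frac12),m+\frac12}\big)(\tau,z_1+z_2).$$ The function $\widetilde\Phi^{[B;m]}(\tau,z_1,z_2,t)$ is defined for $z_1,z_2\notin\mathbb Z+\tau\mathbb Z$. For $M\in\mathbb Z_{\ge1}$, $\epsilon,\epsilon'\in\{0,\frac12\}$ and $a,b\in\epsilon'+\mathbb Z$ with $a-b\in2\mathbb Z$ put $$\widetilde\Psi^{[B;M,m;\epsilon]}_{a,b;\epsilon'}(\tau,z_1,z_2,t)=q^{\frac{2m+1}{2M}ab}\,e^{\frac{2\pi i(2m+1)}{2M}(bz_1+az_2)}\,\widetilde\Phi^{[B;m]}\big(M\tau,\;z_1+a\tau+\epsilon,\;z_2+b\tau+\epsilon,\;\tfrac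 tM\big),$$ $$\Omega^{[B;M;\epsilon]}=\{(a,b)\in(\epsilon+\mathbb Z)^2:\ -M\le a<M,\ 0\le b<M,\ a-b\in2\mathbb Z\}.$$ **Theorem.** Let $m\in\mathbb Z_{\ge0}$ and $M\in\mathbb Z_{\ge1}$ satisfy $\gcd(M,4m+2)=1$, and let $\epsilon,\epsilon'\in\{0,\frac12\}$. Then for all $(j,k)\in\Omega^{[B;M;\epsilon']}$, all $\tau$ with $\operatorname{Im}\tau>0$ and all $z_1,z_2,t\in\mathbb C$ at which the functions involved are defined: (1) $\displaystyle \widetilde\Psi^{[B;M,m;\epsilon]}_{j,k;\epsilon'}\Big(-\frac1\tau,\frac{z_1}\tau,\frac{z_2}\tau,t-\frac{z_1z_2}{\tau}\Big)=\frac\tau M(-1)^{\epsilon'+j}\sum_{(a,b)\in\Omega^{[B;M;\epsilon]}}(-1)^{a-\epsilon}e^{-\frac{2\pi i(2m+1)}{2M}(ak+bj)}\,\widetilde\Psi^{[B;M,m;\epsilon']}_{a,b;\epsilon}(\tau,z_1,z_2,t);$ (2) $\displaystyle \widetilde\Psi^{[B;M,m;\epsilon]}_{j,k;\epsilon'}(\tau+1,z_1,z_2,t)=(-1)^{j-\epsilon'+4\epsilon\epsilon'}e^{\frac{2\pi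 i(2m+1)}{2M}jk}\,\widetilde\Psi^{[B;M,m;|\epsilon-\epsilon'|]}_{j,k;\epsilon'}(\tau,z_1,z_2,t).$ -/

import Mathlib

open Complex

noncomputable section

namespace OspB

/-- `q ^ x = e^{2πi τ x}` for `q = e^{2πi τ}` and an arbitrary exponent `x`. -/
def qpow (τ x : ℂ) : ℂ := exp (2 * Real.pi * I * τ * x)

/-- `Φ₁^{[B;m]}(τ, z₁, z₂, t)`, an absolutely convergent series when `Im τ > 0` and
`z₁ ∉ ℤ + τℤ`. -/
def Phi1 (m : ℕ) (τ z₁ z₂ t : ℂ) : ℂ :=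
  exp (2 * Real.pi * I * (m + 1 / 2) * t) *
    ∑' j : ℤ, (-1 : ℂ) ^ j *
      (exp (Real.pi * I * j * (2 * m + 1) * (z₁ + z₂) + Real.pi * I * z₁) *
          qpow τ ((m + 1 / 2) * (j : ℂ) ^ 2 + j / 2) /
        (1 - exp (2 * Real.pi * I * z₁) * qpow τ j))

/-- The mock theta function `Φ^{[B;m]}(τ, z₁, z₂, t)`. -/
def Phi (m : ℕ) (τ z₁ z₂ t : ℂ) : ℂ := Phi1 m τ z₁ z₂ t - Phi1 m τ z₂ z₁ t

/-- The alternate theta function `Θ⁻_{j,d}(τ, z)` of degree `d` (at `t = 0`). -/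
def ThetaMinus (j d : ℝ) (τ z : ℂ) : ℂ :=
  ∑' n : ℤ, (-1 : ℂ) ^ n *
    (exp (2 * Real.pi * I * d * z * (n + j / (2 * d))) *
      qpow τ (d * ((n : ℂ) + j / (2 * d)) ^ 2))

/-- `E(x) = 2 ∫_0^x e^{-π u²} du`. -/
def gaussE (x : ℝ) : ℝ := 2 * ∫ u in (0 : ℝ)..x, Real.exp (-Real.pi * u ^ 2)

/-- The summand of `R^{[B]}_{j+1/2, m+1/2}(τ, v)` attached to the half-integer `n`,
without the alternating sign. -/
def RBterm (m : ℕ) (τ v : ℂ) (n : ℝ) : ℂ :=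
  ((Real.sign n -
      gaussE ((n + (2 * m + 1) * (v.im / τ.im)) * Real.sqrt (τ.im / (m + 1 / 2))) : ℝ) : ℂ) *
    exp (-(Real.pi * I * (n : ℂ) ^ 2 * τ / (2 * m + 1)) - 2 * Real.pi * I * n * v)

/-- The real analytic function `R^{[B]}_{j+1/2, m+1/2}(τ, v)`. The half-integers
`n ≡ j + 1/2 mod 2m+1` are written as `n = j + 1/2 + (2m+1) l` with `l ∈ ℤ`, so that
`(-1)^{n-(j+1/2)} = (-1)^{(2m+1) l}`. -/
def RB (j m : ℕ) (τ v : ℂ) : ℂ :=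
  ∑' l : ℤ, (-1 : ℂ) ^ ((2 * (m : ℤ) + 1) * l) *
    RBterm m τ v ((j : ℝ) + 1 / 2 + (2 * m + 1) * l)

/-- The additional term `Φ_add^{[B;m]}(τ, z₁, z₂, t)`. -/
def PhiAdd (m : ℕ) (τ z₁ z₂ t : ℂ) : ℂ :=
  1 / 2 * exp (2 * Real.pi * I * (m + 1 / 2) * t) *
    ∑ j ∈ Finset.range (2 * m + 1),
      RB j m τ ((z₁ - z₂) / 2) *
        (ThetaMinus ((j : ℝ) + 1 / 2) ((m : ℝ) + 1 / 2) τ (z₁ + z₂) +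
          ThetaMinus (-((j : ℝ) + 1 / 2)) ((m : ℝ) + 1 / 2) τ (z₁ + z₂))

/-- The modification `Φ̃^{[B;m]} = Φ^{[B;m]} + Φ_add^{[B;m]}`. -/
def PhiTilde (m : ℕ) (τ z₁ z₂ t : ℂ) : ℂ := Phi m τ z₁ z₂ t + PhiAdd m τ z₁ z₂ t

/-- The function `Ψ̃^{[B;M,m;ε]}_{a,b;ε'}(τ, z₁, z₂, t)`. The last index `ε'` only records that
`a, b ∈ ε' + ℤ`; it does not enter the formula. -/
def PsiTilde (M m : ℕ) (ε a b _ε' : ℝ) (τ z₁ z₂ t : ℂ) : ℂ :=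
  qpow τ ((2 * m + 1) / (2 * M) * a * b) *
    exp (2 * Real.pi * I * (2 * m + 1) / (2 * M) * (b * z₁ + a * z₂)) *
    PhiTilde m (M * τ) (z₁ + a * τ + ε) (z₂ + b * τ + ε) (t / M)

/-- `(τ, z₁, z₂)` lies off the poles `z₁ ∈ ℤ + τℤ`, `z₂ ∈ ℤ + τℤ` of `Φ^{[B;m]}`
(equivalently of `Φ̃^{[B;m]}`). -/
def PhiRegular (τ z₁ z₂ : ℂ) : Prop :=
  ∀ p r : ℤ, z₁ ≠ p + r * τ ∧ z₂ ≠ p + r * τ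

/-- `(τ, z₁, z₂)` lies off the poles of `Ψ̃^{[B;M,m;ε]}_{a,b;ε'}`. -/
def PsiRegular (M : ℕ) (ε a b : ℝ) (τ z₁ z₂ : ℂ) : Prop :=
  PhiRegular (M * τ) (z₁ + a * τ + ε) (z₂ + b * τ + ε)

/-- The index set `Ω^{[B;M;ε]}`. -/
def Omega (M : ℕ) (ε : ℝ) : Set (ℝ × ℝ) :=
  {p | (∃ n : ℤ, p.1 = ε + n) ∧ (∃ n : ℤ, p.2 = ε + n) ∧
    -(M : ℝ) ≤ p.1 ∧ p.1 < M ∧ 0 ≤ p.2 ∧ p.2 < M ∧ ∃ l : ℤ, p.1 - p.2 = 2 * l}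

theorem Omega_finite (M : ℕ) (ε : ℝ) : (Omega M ε).Finite := by
  have hfin : (Set.Icc ⌊-(M : ℝ) - ε⌋ ⌈(M : ℝ) - ε⌉ ×ˢ
      Set.Icc ⌊-(M : ℝ) - ε⌋ ⌈(M : ℝ) - ε⌉ : Set (ℤ × ℤ)).Finite :=
    (Set.finite_Icc _ _).prod (Set.finite_Icc _ _)
  refine (hfin.image (fun n : ℤ × ℤ => ((ε + n.1 : ℝ), (ε + n.2 : ℝ)))).subset ?_
  rintro ⟨x, y⟩ ⟨⟨n, hn⟩, ⟨k, hk⟩, h1, h2, h3, h4, -⟩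
  simp only at hn hk h1 h2 h3 h4
  have hM : (0 : ℝ) ≤ M := Nat.cast_nonneg M
  have a1 := Int.floor_le (-(M : ℝ) - ε)
  have a2 := Int.le_ceil ((M : ℝ) - ε)
  refine ⟨(n, k), ⟨⟨?_, ?_⟩, ⟨?_, ?_⟩⟩, by simp [hn, hk]⟩
  · exact_mod_cast (by linarith : ((⌊-(M : ℝ) - ε⌋ : ℤ) : ℝ) ≤ n)
  · exact_mod_cast (by linarith : (n : ℝ) ≤ ((⌈(M : ℝ) - ε⌉ : ℤ) : ℝ))
  · exact_mod_cast (by linarith : ((⌊-(M : ℝ) - ε⌋ : ℤ) : ℝ) ≤ k)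
  · exact_mod_cast (by linarith : (k : ℝ) ≤ ((⌈(M : ℝ) - ε⌉ : ℤ) : ℝ))

/-- `(-1)^x = e^{πi x}`; it is only used for integers `x` that are written as sums of
half-integers. -/
def signPow (x : ℝ) : ℂ := exp (Real.pi * I * x)

end OspB

end

open Complex

noncomputable section

namespace OspB

/-! The completed function Φ̃ is a lattice sum in disguise. For x = z₁ + rτ + p in z₁ + ℤ + τℤ,
divide by x a Gaussian in x whose width depends on Im τ and whose tilt is Im((z₁ - z₂)/2), and
weight it by signs and by a theta factor in r. Poisson summation over p (`tsum_tiltedGaussian_div`)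
turns each row into 1/sin(π(z₁ + rτ)) plus Fourier terms carrying sgn - E. The sines add up over r
to Φ₁. The Fourier terms, grouped by frequency modulo 2m+1, become the products R·Θ⁻. So Φ̃ is, up
to an exponential factor, the antisymmetrization in z₁, z₂ of the absolutely convergent series
`poincare` (`PhiTilde_eq_poincare`).

For such a series modularity is a change of lattice basis: τ ↦ τ + 1 shears the indices and τ ↦ -1/τ
rotates them, while the summand changes only by elementary factors (`poincare_add_int`,
`poincare_neg_inv`). This already gives (2).

In (1), M(-1/τ) = -1/(τ/M), so the left side is a lattice sum at τ/M and the right side consists of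
sums at Mτ. All of them are subsums of one family indexed by (b, P) ∈ ℤ²: the left side fixes P
modulo M, and the term (a, b) = (ε + A, ε + B) on the right fixes the first index modulo M by A and
twists by a character of P with parameter B - A. As M is odd, Ω represents (ℤ/M)², and orthogonality
of characters, available because 2(2m+1) is a unit modulo M, extracts the class of P
(`poincare_level`). -/

/-! ### Gaussian tails and the function E. -/

theorem summable_exp_quadratic {c : ℝ} (hc : 0 < c) (d : ℝ) :
    Summable fun n : ℤ => Real.exp (-c * (n : ℝ) ^ 2 + d * n) := by
  have h := ((summable_jacobiTheta₂_term_iff (-(d / (2 * Real.pi)) * I) ((c / Real.pi) * I)).2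
    (by simpa using div_pos hc Real.pi_pos)).norm
  refine h.congr fun n => ?_
  rw [norm_jacobiTheta₂_term]
  congr 1
  have := Real.pi_ne_zero
  simp [div_im, div_re]
  norm_cast
  push_cast
  field_simp
  ring

theorem integral_Ioi_comp_add_right (f : ℝ → ℝ) (c d : ℝ) :
    ∫ x in Set.Ioi c, f (x + d) = ∫ x in Set.Ioi (c + d), f x := by
  have h := (MeasureTheory.measurePreserving_add_right MeasureTheory.volume d).setIntegral_preimage_emb
    (measurableEmbedding_addRight d) f (Set.Ioi (c + d))
  rw [← h]
  congr 2
  simp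

theorem integrable_exp_neg_pi_sq :
    MeasureTheory.Integrable fun u : ℝ => Real.exp (-Real.pi * u ^ 2) :=
  integrable_exp_neg_mul_sq Real.pi_pos

theorem integral_exp_neg_pi_sq_Ioi :
    ∫ u in Set.Ioi (0 : ℝ), Real.exp (-Real.pi * u ^ 2) = 1 / 2 := by
  rw [integral_gaussian_Ioi, div_self Real.pi_ne_zero, Real.sqrt_one]

theorem one_sub_gaussE (x : ℝ) :
    1 - gaussE x = 2 * ∫ u in Set.Ioi x, Real.exp (-Real.pi * u ^ 2) := by
  have h := intervalIntegral.integral_Ioi_sub_Ioi'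
    (integrable_exp_neg_pi_sq.integrableOn (s := Set.Ioi 0))
    (integrable_exp_neg_pi_sq.integrableOn (s := Set.Ioi x))
  rw [integral_exp_neg_pi_sq_Ioi] at h
  rw [gaussE, ← h]
  ring

theorem gaussE_neg (x : ℝ) : gaussE (-x) = -gaussE x := by
  have h := intervalIntegral.integral_comp_neg (a := 0) (b := x)
    (fun u : ℝ => Real.exp (-Real.pi * u ^ 2))
  simp only [neg_zero, neg_sq] at h
  rw [gaussE, gaussE, h, intervalIntegral.integral_symm (-x) 0]
  ring

theorem gaussE_le_one (x : ℝ) : gaussE x ≤ 1 := by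
  have h := one_sub_gaussE x
  have h2 : 0 ≤ ∫ u in Set.Ioi x, Real.exp (-Real.pi * u ^ 2) :=
    MeasureTheory.integral_nonneg fun u => (Real.exp_pos _).le
  linarith

theorem one_sub_gaussE_le {x : ℝ} (hx : 0 ≤ x) :
    1 - gaussE x ≤ Real.exp (-Real.pi * x ^ 2) := by
  have hshift : ∫ u in Set.Ioi x, Real.exp (-Real.pi * u ^ 2) =
      ∫ u in Set.Ioi (0 : ℝ), Real.exp (-Real.pi * (u + x) ^ 2) := by
    rw [integral_Ioi_comp_add_right (fun u : ℝ => Real.exp (-Real.pi * u ^ 2)) 0 x, zero_add]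
  rw [one_sub_gaussE, hshift]
  have hle : ∫ u in Set.Ioi (0 : ℝ), Real.exp (-Real.pi * (u + x) ^ 2) ≤
      ∫ u in Set.Ioi (0 : ℝ), Real.exp (-Real.pi * x ^ 2) * Real.exp (-Real.pi * u ^ 2) := by
    refine MeasureTheory.setIntegral_mono_on
      (integrable_exp_neg_pi_sq.comp_add_right x).integrableOn
      (integrable_exp_neg_pi_sq.const_mul _).integrableOn measurableSet_Ioi fun u hu => ?_
    rw [← Real.exp_add]
    refine Real.exp_le_exp.2 ?_
    have : 0 ≤ Real.pi * (u * x) := by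
      have : 0 < u := hu
      positivity
    nlinarith
  rw [MeasureTheory.integral_const_mul, integral_exp_neg_pi_sq_Ioi] at hle
  linarith

/-- If ν + h < 0 the left side is not small, but then |ν + h| ≤ |h|, so the factor exp(π(h/ρ)²)
absorbs the trivial bound 2. The estimate is thus uniform in ν > 0. -/
theorem abs_one_sub_gaussE_le {ν h ρ : ℝ} (hν : 0 < ν) (hρ : 0 < ρ) :
    |1 - gaussE ((ν + h) / ρ)| ≤
      2 * Real.exp (Real.pi * (h / ρ) ^ 2) * Real.exp (-Real.pi * ((ν + h) / ρ) ^ 2) := by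
  rw [abs_of_nonneg (by linarith [gaussE_le_one ((ν + h) / ρ)])]
  rcases le_or_gt 0 (ν + h) with h0 | h0
  · have h1 := one_sub_gaussE_le (div_nonneg h0 hρ.le)
    have h2 : 1 ≤ Real.exp (Real.pi * (h / ρ) ^ 2) :=
      Real.one_le_exp (by positivity)
    nlinarith [Real.exp_pos (-Real.pi * ((ν + h) / ρ) ^ 2)]
  · have h1 := gaussE_le_one (-((ν + h) / ρ))
    rw [gaussE_neg] at h1
    rw [mul_assoc, ← Real.exp_add]
    have h2 : 1 ≤ Real.exp (Real.pi * (h / ρ) ^ 2 + -Real.pi * ((ν + h) / ρ) ^ 2) := by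
      refine Real.one_le_exp ?_
      have h3 : ((ν + h) / ρ) ^ 2 ≤ (h / ρ) ^ 2 := by
        rw [div_pow, div_pow]
        gcongr 1
        nlinarith
      nlinarith [Real.pi_pos]
    linarith

theorem abs_sign_sub_gaussE_le {ν : ℝ} (h : ℝ) {ρ : ℝ} (hν : ν ≠ 0) (hρ : 0 < ρ) :
    |Real.sign ν - gaussE ((ν + h) / ρ)| ≤
      2 * Real.exp (Real.pi * (h / ρ) ^ 2) * Real.exp (-Real.pi * ((ν + h) / ρ) ^ 2) := by
  rcases lt_or_gt_of_ne hν with h0 | h0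
  · have h1 := abs_one_sub_gaussE_le (ν := -ν) (h := -h) (by linarith) hρ
    have h2 : (-ν + -h) / ρ = -((ν + h) / ρ) := by ring
    rw [h2, gaussE_neg, neg_sq, neg_div, neg_sq] at h1
    rw [Real.sign_of_neg h0, ← abs_neg]
    convert h1 using 2
    ring
  · rw [Real.sign_of_pos h0]
    exact abs_one_sub_gaussE_le h0 hρ

theorem int_add_half_ne_zero (n : ℤ) : (n : ℝ) + 1 / 2 ≠ 0 := by
  intro h
  have : (2 * n + 1 : ℤ) = 0 := by
    have : (2 * n + 1 : ℝ) = 0 := by linarith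
    exact_mod_cast this
  omega

/-- The difference `sgn(ν) - E((ν + 2aV)/√a)` beats the growth of `exp(π ν² / (2a))`. -/
theorem summable_sign_sub_gaussE_mul_exp {a : ℝ} (ha : 0 < a) (V κ : ℝ) :
    Summable fun n : ℤ => |Real.sign ((n : ℝ) + 1 / 2) -
        gaussE (((n : ℝ) + 1 / 2 + 2 * a * V) / √a)| *
      Real.exp (Real.pi / (2 * a) * ((n : ℝ) + 1 / 2) ^ 2 + κ * ((n : ℝ) + 1 / 2)) := by
  -- The tail decays like exp(-πν²/a), twice the rate of the growth exp(πν²/(2a)); the constants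
  -- come from expanding the resulting quadratic at ν = n + 1/2.
  have hs := (summable_exp_quadratic (c := Real.pi / (2 * a)) (by positivity)
    (κ - 4 * Real.pi * V - Real.pi / (2 * a))).mul_left
    (2 * Real.exp (Real.pi * (2 * a * V / √a) ^ 2) *
      Real.exp (-Real.pi / (8 * a) - 4 * Real.pi * a * V ^ 2 + (κ - 4 * Real.pi * V) / 2))
  refine Summable.of_nonneg_of_le (fun n => by positivity) (fun n => ?_) hs
  have hb := abs_sign_sub_gaussE_le (2 * a * V) (int_add_half_ne_zero n) (Real.sqrt_pos.2 ha)
  calc _ ≤ _ := mul_le_mul_of_nonneg_right hb (Real.exp_pos _).le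
    _ = _ := by
      rw [mul_assoc _ (Real.exp (-Real.pi * _)) (Real.exp _), ← Real.exp_add,
        mul_assoc _ (Real.exp (-Real.pi / _ - _ + _)) (Real.exp _), ← Real.exp_add]
      congr 2
      rw [div_pow, Real.sq_sqrt ha.le]
      field_simp
      ring

theorem Summable.div_of_eventually_one_le {ι : Type*} {f g : ι → ℂ} (hf : Summable fun i => ‖f i‖)
    (hg : ∀ᶠ i in Filter.cofinite, 1 ≤ ‖g i‖) : Summable fun i => f i / g i := by
  refine Summable.of_norm_bounded_eventually hf ?_
  filter_upwards [hg] with i hi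
  rw [norm_div]
  exact div_le_self (norm_nonneg _) hi

theorem norm_neg_one_zpow (n : ℤ) : ‖(-1 : ℂ) ^ n‖ = 1 := by
  rw [norm_zpow, norm_neg, norm_one, one_zpow]

theorem neg_one_zpow_eq_exp (n : ℤ) : (-1 : ℂ) ^ n = exp (Real.pi * I * n) := by
  rw [mul_comm, exp_int_mul, exp_pi_mul_I]

/-! ### Poisson summation for a tilted Gaussian, without and with a simple pole. -/

/-- The Gaussian `exp(-πa(x² - 4iVx))`. -/
def tiltedGaussian (a V : ℝ) (x : ℂ) : ℂ := exp (-Real.pi * a * (x ^ 2 - 4 * I * V * x))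

theorem norm_tiltedGaussian (a V : ℝ) (x : ℂ) : ‖tiltedGaussian a V x‖ =
    Real.exp (-Real.pi * a * (x.re ^ 2 - x.im ^ 2 + 4 * V * x.im)) := by
  rw [tiltedGaussian, norm_exp]
  congr 1
  simp [pow_two]

theorem summable_norm_tiltedGaussian {a : ℝ} (ha : 0 < a) (V : ℝ) (w : ℂ) :
    Summable fun p : ℤ => ‖tiltedGaussian a V (w + p)‖ := by
  have h := (summable_exp_quadratic (c := Real.pi * a) (by positivity)
    (-2 * Real.pi * a * w.re)).mul_left
      (Real.exp (-Real.pi * a * (w.re ^ 2 - w.im ^ 2 + 4 * V * w.im)))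
  refine h.congr fun p => ?_
  rw [norm_tiltedGaussian, ← Real.exp_add]
  congr 1
  simp
  ring

theorem eventually_one_le_norm_add_int (w : ℂ) :
    ∀ᶠ p : ℤ in Filter.cofinite, 1 ≤ ‖w + p‖ := by
  rw [Filter.eventually_cofinite]
  refine (Set.finite_Icc (-⌈1 + ‖w‖⌉) ⌈1 + ‖w‖⌉).subset fun p hp => ?_
  simp only [Set.mem_ofPred_eq, not_le] at hp
  have h1 : |(p : ℝ)| ≤ 1 + ‖w‖ := by
    have h2 : ‖(p : ℂ)‖ ≤ ‖w + p‖ + ‖w‖ := by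
      simpa using norm_sub_le (w + p) w
    rw [norm_intCast] at h2
    linarith
  have h3 := h1.trans (Int.le_ceil _)
  have h4 : |p| ≤ ⌈1 + ‖w‖⌉ := by exact_mod_cast h3
  exact abs_le.1 h4

theorem summable_tiltedGaussian_div {a : ℝ} (ha : 0 < a) (V : ℝ) (w : ℂ) :
    Summable fun p : ℤ => (-1 : ℂ) ^ p * (tiltedGaussian a V (w + p) / (w + p)) := by
  have h := Summable.div_of_eventually_one_le (summable_norm_tiltedGaussian ha V w)
    (eventually_one_le_norm_add_int w)
  refine Summable.of_norm (h.norm.congr fun p => ?_)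
  rw [norm_mul, norm_neg_one_zpow, one_mul]

theorem tsum_tiltedGaussian {a : ℝ} (ha : 0 < a) (V : ℝ) (w : ℂ) :
    ∑' p : ℤ, (-1 : ℂ) ^ p * tiltedGaussian a V (w + p) =
      (1 / √a : ℝ) * ∑' n : ℤ,
        (Real.exp (-Real.pi / a * ((n : ℝ) + 1 / 2 + 2 * a * V) ^ 2) : ℝ) *
          exp (-2 * Real.pi * I * (n + 1 / 2) * w) := by
  have ha' : (a : ℂ) ≠ 0 := by exact_mod_cast ha.ne'
  -- The summand I / 2 encodes the sign (-1)^p = e^{πip}; it moves the dual lattice to ℤ + 1/2, the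
  -- source of all half-integral frequencies.
  have h := Complex.tsum_exp_neg_quadratic (a := a) (by simpa using ha)
    (-a * w + 2 * I * a * V + I / 2)
  have hs : (a : ℂ) ^ (1 / 2 : ℂ) = (√a : ℝ) := by
    rw [Real.sqrt_eq_rpow, ofReal_cpow ha.le]
    norm_num
  rw [hs] at h
  have e1 : ∀ p : ℤ, (-1 : ℂ) ^ p * tiltedGaussian a V (w + p) =
      exp (-Real.pi * a * (w ^ 2 - 4 * I * V * w)) *
      exp (-Real.pi * a * p ^ 2 + 2 * Real.pi * (-a * w + 2 * I * a * V + I / 2) * p) := by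
    intro p
    rw [neg_one_zpow_eq_exp, tiltedGaussian, ← exp_add, ← exp_add]
    congr 1
    ring
  rw [tsum_congr e1, tsum_mul_left, h, ← (Equiv.neg ℤ).tsum_eq]
  rw [mul_left_comm, ← tsum_mul_left]
  push_cast
  congr 1
  refine tsum_congr fun n => ?_
  rw [← exp_add, ← exp_add]
  congr 1
  simp only [Equiv.neg_apply, Int.cast_neg]
  field_simp
  ring_nf
  simp only [I_sq, I_pow_three, I_pow_four]
  ring

theorem exp_geometric_eq_inv_sin {w : ℂ} (hw : exp (2 * Real.pi * I * w) ≠ 1) :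
    exp (Real.pi * I * w) * (1 - exp (2 * Real.pi * I * w))⁻¹ = I / 2 / sin (Real.pi * w) := by
  have hne : 1 - exp (2 * Real.pi * I * w) ≠ 0 := sub_ne_zero.2 hw.symm
  have hE : exp (2 * Real.pi * I * w) = exp (Real.pi * I * w) ^ 2 := by
    rw [← exp_nat_mul]
    congr 1
    push_cast
    ring
  have hne0 := exp_ne_zero (Real.pi * I * w)
  have hsin : sin (Real.pi * w) =
      I / 2 * ((1 - exp (Real.pi * I * w) ^ 2) / exp (Real.pi * I * w)) := by
    rw [Complex.sin, show -(Real.pi * w) * I = -(Real.pi * I * w) by ring,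
      show Real.pi * w * I = Real.pi * I * w by ring, exp_neg]
    field_simp
  rw [hE] at hne ⊢
  rw [hsin]
  field_simp

/-- The factor 1 - sgn removes n ≥ 0 and leaves a geometric series in e^{2πiw}, convergent in the
upper half-plane. -/
theorem hasSum_half_one_sub_sign {w : ℂ} (hw : 0 < w.im) :
    HasSum (fun n : ℤ => 1 / 2 * ((1 - Real.sign ((n : ℝ) + 1 / 2) : ℝ) : ℂ) *
      exp (-2 * Real.pi * I * (n + 1 / 2) * w)) (I / 2 / sin (Real.pi * w)) := by
  have hlt : ‖exp (2 * Real.pi * I * w)‖ < 1 := by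
    rw [norm_exp, Real.exp_lt_one_iff]
    simp only [mul_re, mul_im, re_ofNat, im_ofNat, ofReal_re, ofReal_im, I_re, I_im]
    ring_nf
    nlinarith [mul_pos Real.pi_pos hw]
  have hne : exp (2 * Real.pi * I * w) ≠ 1 := by
    intro h0
    rw [h0, norm_one] at hlt
    exact lt_irrefl _ hlt
  rw [← exp_geometric_eq_inv_sin hne, ← zero_add (exp (Real.pi * I * w) * _)]
  refine HasSum.of_nat_of_neg_add_one ?_ ?_
  · refine hasSum_zero.congr_fun fun n => ?_
    have : (0 : ℝ) < ((n : ℤ) : ℝ) + 1 / 2 := by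
      push_cast
      positivity
    rw [Real.sign_of_pos this, sub_self, ofReal_zero, mul_zero, zero_mul]
  · refine ((hasSum_geometric_of_norm_lt_one hlt).mul_left _).congr_fun fun n => ?_
    have : (((-((n : ℤ) + 1) : ℤ) : ℝ) + 1 / 2) < 0 := by
      push_cast
      have : (0 : ℝ) ≤ n := Nat.cast_nonneg n
      linarith
    rw [Real.sign_of_neg this, ← exp_nat_mul, ← exp_add]
    norm_num
    congr 1
    ring

/-- The Fourier coefficient attached to `n + 1/2` of the non-holomorphic correction. -/
def errorTerm (a V : ℝ) (w : ℂ) (n : ℤ) : ℂ :=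
  1 / 2 * ((Real.sign ((n : ℝ) + 1 / 2) - gaussE (((n : ℝ) + 1 / 2 + 2 * a * V) / √a) : ℝ) : ℂ) *
    exp (-2 * Real.pi * I * (n + 1 / 2) * w)

theorem norm_exp_neg_two_pi_I_mul (n : ℤ) (w : ℂ) :
    ‖exp (-2 * Real.pi * I * (n + 1 / 2) * w)‖ =
      Real.exp (2 * Real.pi * w.im * ((n : ℝ) + 1 / 2)) := by
  rw [norm_exp]
  congr 1
  simp
  ring

theorem summable_errorTerm {a : ℝ} (ha : 0 < a) (V : ℝ) (w : ℂ) : Summable (errorTerm a V w) := by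
  refine Summable.of_norm_bounded (summable_sign_sub_gaussE_mul_exp ha V (2 * Real.pi * w.im))
    fun n => ?_
  rw [errorTerm, norm_mul, norm_mul, norm_exp_neg_two_pi_I_mul, norm_real, Real.norm_eq_abs]
  refine mul_le_mul ?_ ?_ (Real.exp_pos _).le (abs_nonneg _)
  · norm_num
    linarith [abs_nonneg (Real.sign ((n : ℝ) + 1 / 2) -
      gaussE (((n : ℝ) + 1 / 2 + 2 * a * V) / √a))]
  · refine Real.exp_le_exp.2 ?_
    have : 0 ≤ Real.pi / (2 * a) * ((n : ℝ) + 1 / 2) ^ 2 := by positivity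
    linarith

/-- Integrating the dual Gaussian over the tilt is what creates E. This is the Fourier-side
counterpart of `integral_tiltedGaussian`. -/
theorem integral_Ioi_gaussian_shift {a : ℝ} (ha : 0 < a) (V ν : ℝ) :
    ∫ v in Set.Ioi V, 2 * √a * Real.exp (-Real.pi / a * (ν + 2 * a * v) ^ 2) =
      1 / 2 * (1 - gaussE ((ν + 2 * a * V) / √a)) := by
  have hs := Real.sqrt_pos.2 ha
  have hss := Real.sq_sqrt ha.le
  rw [one_sub_gaussE, MeasureTheory.integral_const_mul]
  have h := MeasureTheory.integral_comp_mul_left_Ioi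
    (fun u : ℝ => Real.exp (-Real.pi * (u + ν / √a) ^ 2)) V (b := 2 * √a) (by positivity)
  rw [integral_Ioi_comp_add_right (fun u : ℝ => Real.exp (-Real.pi * u ^ 2))] at h
  have e : ∀ v : ℝ, -Real.pi / a * (ν + 2 * a * v) ^ 2 =
      -Real.pi * (2 * √a * v + ν / √a) ^ 2 := by
    intro v
    rw [show 2 * √a * v + ν / √a = (ν + 2 * a * v) / √a by
      field_simp
      rw [hss]
      ring, div_pow, hss]
    ring
  simp_rw [e]
  rw [h, show 2 * √a * V + ν / √a = (ν + 2 * a * V) / √a by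
      field_simp
      rw [hss]
      ring, smul_eq_mul]
  field_simp

theorem tiltedGaussian_eq (a v : ℝ) (x : ℂ) : tiltedGaussian a v x =
    exp (-Real.pi * a * x ^ 2) * exp ((4 * Real.pi * a * I * x) * v) := by
  rw [tiltedGaussian, ← exp_add]
  congr 1
  ring

theorem tilt_re_neg {a : ℝ} (ha : 0 < a) {x : ℂ} (hx : 0 < x.im) :
    (4 * Real.pi * a * I * x).re < 0 := by
  have := mul_pos (mul_pos Real.pi_pos ha) hx
  simp
  linarith

theorem integrableOn_tiltedGaussian {a : ℝ} (ha : 0 < a) (V : ℝ) {x : ℂ} (hx : 0 < x.im) :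
    MeasureTheory.IntegrableOn (fun v : ℝ => tiltedGaussian a v x) (Set.Ioi V) := by
  simp_rw [tiltedGaussian_eq]
  exact (integrableOn_exp_mul_complex_Ioi (tilt_re_neg ha hx) V).const_mul _

/-- The tilt v enters through e^{4πiaxv}, which decays when Im x > 0, so integrating over v > V
produces the pole 1/x. -/
theorem integral_tiltedGaussian {a : ℝ} (ha : 0 < a) (V : ℝ) {x : ℂ} (hx : 0 < x.im) :
    ∫ v in Set.Ioi V, 2 * a * tiltedGaussian a v x =
      I / (2 * Real.pi) * (tiltedGaussian a V x / x) := by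
  have hx0 : x ≠ 0 := by
    rintro rfl
    simp at hx
  have ha0 : (a : ℂ) ≠ 0 := by exact_mod_cast ha.ne'
  simp_rw [tiltedGaussian_eq]
  rw [MeasureTheory.integral_const_mul, MeasureTheory.integral_const_mul,
    integral_exp_mul_complex_Ioi (tilt_re_neg ha hx)]
  have := I_ne_zero
  field_simp
  rw [I_sq]
  ring

theorem integral_norm_tiltedGaussian {a : ℝ} (ha : 0 < a) (V : ℝ) {x : ℂ} (hx : 0 < x.im) :
    ∫ v in Set.Ioi V, ‖2 * a * tiltedGaussian a v x‖ =
      (2 * a * (4 * Real.pi * a * x.im)⁻¹) * ‖tiltedGaussian a V x‖ := by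
  have h1 : -(4 * Real.pi * a * x.im) < 0 := by
    have := mul_pos (mul_pos Real.pi_pos ha) hx
    linarith
  have e : ∀ v : ℝ, ‖2 * a * tiltedGaussian a v x‖ =
      2 * a * (Real.exp (-Real.pi * a * (x.re ^ 2 - x.im ^ 2)) *
        Real.exp (-(4 * Real.pi * a * x.im) * v)) := by
    intro v
    rw [norm_mul, norm_tiltedGaussian, ← Real.exp_add]
    congr 1
    · rw [norm_mul, norm_real, Real.norm_of_nonneg ha.le]
      simp
    · congr 1
      ring
  have e2 : ‖tiltedGaussian a V x‖ = (Real.exp (-Real.pi * a * (x.re ^ 2 - x.im ^ 2)) *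
        Real.exp (-(4 * Real.pi * a * x.im) * V)) := by
    rw [norm_tiltedGaussian, ← Real.exp_add]
    congr 1
    ring
  simp_rw [e]
  rw [MeasureTheory.integral_const_mul, MeasureTheory.integral_const_mul,
    integral_exp_mul_Ioi h1, e2]
  field_simp

/-- Poisson summation for the entire Gaussian holds at every tilt v; integrating it over v > V gives
the pole on one side. On the other side 1 - E splits as (1 - sgn) + (sgn - E): the first part sums
to the inverse sine, the second to the error terms. -/
theorem tsum_tiltedGaussian_div_of_im_pos {a : ℝ} (ha : 0 < a) (V : ℝ) {w : ℂ} (hw : 0 < w.im) :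
    I / (2 * Real.pi) * ∑' p : ℤ, (-1 : ℂ) ^ p * (tiltedGaussian a V (w + p) / (w + p)) =
      I / 2 / sin (Real.pi * w) + ∑' n : ℤ, errorTerm a V w n := by
  have him : ∀ p : ℤ, 0 < (w + p).im := fun p => by simpa using hw
  have hs := Real.sqrt_pos.2 ha
  have hss := Real.sq_sqrt ha.le
  have nmul : ∀ (p : ℤ) (z : ℂ), ‖(-1 : ℂ) ^ p * z‖ = ‖z‖ := fun p z => by
    rw [norm_mul, norm_neg_one_zpow, one_mul]
  have hL := MeasureTheory.hasSum_integral_of_summable_integral_norm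
    (μ := MeasureTheory.volume.restrict (Set.Ioi V))
    (F := fun (p : ℤ) (v : ℝ) => (-1 : ℂ) ^ p * (2 * a * tiltedGaussian a v (w + p)))
    (fun p => ((integrableOn_tiltedGaussian ha V (him p)).const_mul (2 * a : ℂ)).const_mul _)
    (by
      simp_rw [nmul, fun p : ℤ => integral_norm_tiltedGaussian ha V (him p)]
      simpa using (summable_norm_tiltedGaussian ha V w).mul_left (2 * a * (4 * Real.pi * a * w.im)⁻¹))
  simp_rw [MeasureTheory.integral_const_mul ((-1 : ℂ) ^ (_ : ℤ)),
    fun p : ℤ => integral_tiltedGaussian ha V (him p)] at hL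
  have hg : ∀ n : ℤ, MeasureTheory.IntegrableOn (fun v : ℝ => 2 * √a *
      Real.exp (-Real.pi / a * ((n : ℝ) + 1 / 2 + 2 * a * v) ^ 2)) (Set.Ioi V) := by
    intro n
    refine (MeasureTheory.Integrable.const_mul ?_ _).integrableOn
    have := ((integrable_exp_neg_mul_sq (b := Real.pi / a) (by positivity)).comp_add_left
      ((n : ℝ) + 1 / 2)).comp_mul_left' (R := 2 * a) (by positivity)
    refine this.congr (Filter.Eventually.of_forall fun v => ?_)
    simp only [neg_div]
  have hI : ∀ n : ℤ, ∫ v in Set.Ioi V, ((2 * √a *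
      Real.exp (-Real.pi / a * ((n : ℝ) + 1 / 2 + 2 * a * v) ^ 2) : ℝ) : ℂ) *
        exp (-2 * Real.pi * I * (n + 1 / 2) * w) =
      1 / 2 * ((1 - Real.sign ((n : ℝ) + 1 / 2) : ℝ) : ℂ) *
        exp (-2 * Real.pi * I * (n + 1 / 2) * w) + errorTerm a V w n := by
    intro n
    rw [MeasureTheory.integral_mul_const, integral_complex_ofReal, integral_Ioi_gaussian_shift ha, errorTerm]
    push_cast
    ring
  have hsum := (hasSum_half_one_sub_sign hw).add (summable_errorTerm ha V w).hasSum
  -- Each integrand is nonnegative times a factor independent of v, so the integral of its norm is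
  -- the norm of its integral, and summability follows from `hsum`.
  have hR := MeasureTheory.hasSum_integral_of_summable_integral_norm
    (μ := MeasureTheory.volume.restrict (Set.Ioi V))
    (F := fun (n : ℤ) (v : ℝ) => ((2 * √a *
      Real.exp (-Real.pi / a * ((n : ℝ) + 1 / 2 + 2 * a * v) ^ 2) : ℝ) : ℂ) *
        exp (-2 * Real.pi * I * (n + 1 / 2) * w))
    (fun n => ((hg n).ofReal).mul_const _)
    (by
      refine hsum.summable.norm.congr fun n => ?_
      rw [← hI n, MeasureTheory.integral_mul_const, integral_complex_ofReal, norm_mul, norm_real,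
        Real.norm_of_nonneg (MeasureTheory.integral_nonneg fun v => by positivity),
        ← MeasureTheory.integral_mul_const]
      refine MeasureTheory.integral_congr_ae (Filter.Eventually.of_forall fun v => ?_)
      simp only
      rw [norm_mul, norm_real, Real.norm_of_nonneg (by positivity)])
  simp_rw [hI] at hR
  have hpois : ∀ v : ℝ, ∑' p : ℤ, (-1 : ℂ) ^ p * (2 * a * tiltedGaussian a v (w + p)) =
      ∑' n : ℤ, ((2 * √a *
      Real.exp (-Real.pi / a * ((n : ℝ) + 1 / 2 + 2 * a * v) ^ 2) : ℝ) : ℂ) *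
        exp (-2 * Real.pi * I * (n + 1 / 2) * w) := by
    intro v
    have h := tsum_tiltedGaussian ha v w
    simp_rw [mul_left_comm ((-1 : ℂ) ^ (_ : ℤ))]
    rw [tsum_mul_left, h, ← mul_assoc, ← tsum_mul_left]
    refine tsum_congr fun n => ?_
    rw [← mul_assoc]
    congr 1
    norm_cast
    field_simp
    rw [hss]
  simp_rw [hpois] at hL
  have key := hsum.unique hR
  rw [← hL.tsum_eq] at key
  rw [key, ← tsum_mul_left]
  refine tsum_congr fun p => ?_
  ring

theorem errorTerm_reflect (a V : ℝ) (w : ℂ) (n : ℤ) :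
    errorTerm a (-V) (-w) (-1 - n) = -errorTerm a V w n := by
  have e : (((-1 - n : ℤ) : ℝ) + 1 / 2) = -((n : ℝ) + 1 / 2) := by
    push_cast
    ring
  have e1 : (-((n : ℝ) + 1 / 2) + 2 * a * -V) / √a = -(((n : ℝ) + 1 / 2 + 2 * a * V) / √a) := by
    ring
  have e2 : -2 * (Real.pi : ℂ) * I * (((-1 - n : ℤ) : ℂ) + 1 / 2) * -w =
      -2 * Real.pi * I * (n + 1 / 2) * w := by
    push_cast
    ring
  rw [errorTerm, errorTerm, e, e1, e2, gaussE_neg, Real.sign_neg]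
  push_cast
  ring

/-- Both sides are odd under (w, V) ↦ (-w, -V), which carries the lower half-plane to the upper one.
-/
theorem tsum_tiltedGaussian_div_of_im_ne {a : ℝ} (ha : 0 < a) (V : ℝ) {w : ℂ} (hw : w.im ≠ 0) :
    I / (2 * Real.pi) * ∑' p : ℤ, (-1 : ℂ) ^ p * (tiltedGaussian a V (w + p) / (w + p)) =
      I / 2 / sin (Real.pi * w) + ∑' n : ℤ, errorTerm a V w n := by
  rcases lt_or_gt_of_ne hw with h | h
  · have h1 := tsum_tiltedGaussian_div_of_im_pos ha (-V) (w := -w) (by simpa using h)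
    rw [← (Equiv.neg ℤ).tsum_eq, ← (Equiv.subLeft (-1 : ℤ)).tsum_eq (errorTerm a (-V) (-w))] at h1
    have e : ∀ p : ℤ, (-1 : ℂ) ^ (Equiv.neg ℤ p) *
        (tiltedGaussian a (-V) (-w + (Equiv.neg ℤ p : ℤ)) / (-w + (Equiv.neg ℤ p : ℤ))) =
        -((-1 : ℂ) ^ p * (tiltedGaussian a V (w + p) / (w + p))) := by
      intro p
      have e1 : -w + ((Equiv.neg ℤ p : ℤ) : ℂ) = -(w + p) := by
        simp
        ring
      rw [e1, Equiv.neg_apply, zpow_neg, ← inv_zpow, inv_neg, inv_one, div_neg, mul_neg]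
      congr 3
      rw [tiltedGaussian, tiltedGaussian]
      congr 1
      push_cast
      ring
    simp_rw [e, Equiv.subLeft_apply, errorTerm_reflect, tsum_neg] at h1
    rw [mul_neg (Real.pi : ℂ), sin_neg, div_neg] at h1
    linear_combination -h1
  · exact tsum_tiltedGaussian_div_of_im_pos ha V h

theorem norm_tiltedGaussian_div_le {a : ℝ} (ha : 0 < a) (V : ℝ) {x : ℂ} (hx : x.im = 0)
    (hx0 : x ≠ 0) {η : ℝ} (h0 : 0 ≤ η) (h1 : η ≤ 1) :
    ‖tiltedGaussian a V (x + η * I) / (x + η * I)‖ ≤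
      Real.exp (Real.pi * a * (1 + 4 * |V|)) * ‖tiltedGaussian a V x / x‖ := by
  rw [norm_div, norm_div, ← mul_div_assoc]
  refine div_le_div₀ (by positivity) ?_ (norm_pos_iff.2 hx0) ?_
  · rw [norm_tiltedGaussian, norm_tiltedGaussian, ← Real.exp_add, hx]
    refine Real.exp_le_exp.2 ?_
    simp only [add_re, mul_re, ofReal_re, I_re, ofReal_im, I_im, add_im, mul_im, hx]
    have h2 : η ^ 2 ≤ 1 := by nlinarith
    have h3 : -(V * η) ≤ |V| := by
      calc -(V * η) ≤ |V * η| := neg_le_abs _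
        _ = |V| * η := by rw [abs_mul, abs_of_nonneg h0]
        _ ≤ |V| := mul_le_of_le_one_right (abs_nonneg _) h1
    have h4 := mul_pos Real.pi_pos ha
    nlinarith
  · have h2 := abs_re_le_norm (x + η * I)
    have h3 : ‖x‖ = |x.re| := by
      conv_lhs => rw [← re_add_im x, hx]
      simp
    rw [h3]
    simpa using h2

/-- On 0 ≤ η ≤ 1 the exponential factor is at most its value at w = i or w = -i, depending on the
sign of n + 1/2; this gives a summable majorant independent of η. -/
theorem norm_errorTerm_le (a V : ℝ) {w : ℂ} (hw : w.im = 0) {η : ℝ} (h0 : 0 ≤ η) (h1 : η ≤ 1)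
    (n : ℤ) : ‖errorTerm a V (w + η * I) n‖ ≤ ‖errorTerm a V I n‖ + ‖errorTerm a V (-I) n‖ := by
  simp only [errorTerm, norm_mul, norm_exp_neg_two_pi_I_mul]
  rw [← mul_add]
  refine mul_le_mul_of_nonneg_left ?_ (by positivity)
  simp only [add_im, hw, mul_im, ofReal_re, I_im, ofReal_im, I_re, neg_im]
  have hpi := Real.pi_pos
  have e1 := Real.exp_pos (2 * Real.pi * 1 * ((n : ℝ) + 1 / 2))
  have e2 := Real.exp_pos (2 * Real.pi * -1 * ((n : ℝ) + 1 / 2))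
  rcases le_total 0 ((n : ℝ) + 1 / 2) with h | h
  · have : Real.exp (2 * Real.pi * (0 + (η * 1 + 0 * 0)) * ((n : ℝ) + 1 / 2)) ≤
        Real.exp (2 * Real.pi * 1 * ((n : ℝ) + 1 / 2)) := by
      gcongr
      linarith
    linarith
  · have : Real.exp (2 * Real.pi * (0 + (η * 1 + 0 * 0)) * ((n : ℝ) + 1 / 2)) ≤
        Real.exp (2 * Real.pi * -1 * ((n : ℝ) + 1 / 2)) := by
      refine Real.exp_le_exp.2 (mul_le_mul_of_nonpos_right ?_ h)
      nlinarith
    linarith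

/-- Poisson summation for a Gaussian with a simple pole. -/
theorem tsum_tiltedGaussian_div {a : ℝ} (ha : 0 < a) (V : ℝ) {w : ℂ} (hw : ∀ p : ℤ, w + p ≠ 0) :
    I / (2 * Real.pi) * ∑' p : ℤ, (-1 : ℂ) ^ p * (tiltedGaussian a V (w + p) / (w + p)) =
      I / 2 / sin (Real.pi * w) + ∑' n : ℤ, errorTerm a V w n := by
  -- For real nonintegral w the integral representation of 1/x fails. Both sides are continuous
  -- along w + iη for 0 ≤ η ≤ 1 and agree for η > 0, hence also at η = 0.
  by_cases him : w.im = 0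
  swap
  · exact tsum_tiltedGaussian_div_of_im_ne ha V him
  have him' : ∀ p : ℤ, (w + p).im = 0 := fun p => by simpa using him
  have hne : ∀ p : ℤ, ∀ η : ℝ, w + p + η * I ≠ 0 := by
    intro p η h
    have h1 := congrArg im h
    simp only [add_im, him, intCast_im, mul_im, ofReal_re, I_im, ofReal_im, I_re, zero_im] at h1
    have h2 : η = 0 := by linarith
    rw [h2] at h
    exact hw p (by simpa using h)
  have hcL : ContinuousOn (fun η : ℝ => I / (2 * Real.pi) * ∑' p : ℤ, (-1 : ℂ) ^ p *
      (tiltedGaussian a V (w + p + η * I) / (w + p + η * I))) (Set.Icc 0 1) := by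
    refine continuousOn_const.mul (continuousOn_tsum (u := fun p : ℤ =>
      Real.exp (Real.pi * a * (1 + 4 * |V|)) * ‖(-1 : ℂ) ^ p *
        (tiltedGaussian a V (w + p) / (w + p))‖) (fun p => ?_) ?_ fun p η hη => ?_)
    · refine Continuous.continuousOn (continuous_const.mul (Continuous.div ?_ ?_ (hne p)))
      · unfold tiltedGaussian
        fun_prop
      · fun_prop
    · exact (summable_tiltedGaussian_div ha V w).norm.mul_left _
    · rw [norm_mul, norm_neg_one_zpow, norm_mul, norm_neg_one_zpow, one_mul, one_mul]
      exact norm_tiltedGaussian_div_le ha V (him' p) (hw p) hη.1 hη.2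
  have hcR : ContinuousOn (fun η : ℝ => I / 2 / sin (Real.pi * (w + η * I)) +
      ∑' n : ℤ, errorTerm a V (w + η * I) n) (Set.Icc 0 1) := by
    refine ContinuousOn.add (Continuous.continuousOn (continuous_const.div (by fun_prop) ?_))
      (continuousOn_tsum (u := fun n => ‖errorTerm a V I n‖ + ‖errorTerm a V (-I) n‖)
        (fun n => ?_) ?_ fun n η hη => norm_errorTerm_le a V him hη.1 hη.2 n)
    · intro η h
      obtain ⟨k, hk⟩ := sin_eq_zero_iff.1 h
      have hpi : (Real.pi : ℂ) ≠ 0 := by exact_mod_cast Real.pi_ne_zero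
      refine hne (-k) η ?_
      have : w + η * I = k := mul_left_cancel₀ hpi (by rw [hk, mul_comm])
      push_cast
      linear_combination this
    · unfold errorTerm
      exact Continuous.continuousOn (by fun_prop)
    · exact (summable_errorTerm ha V I).norm.add (summable_errorTerm ha V (-I)).norm
  have heq : Set.EqOn (fun η : ℝ => I / (2 * Real.pi) * ∑' p : ℤ, (-1 : ℂ) ^ p *
      (tiltedGaussian a V (w + p + η * I) / (w + p + η * I)))
      (fun η : ℝ => I / 2 / sin (Real.pi * (w + η * I)) +
      ∑' n : ℤ, errorTerm a V (w + η * I) n) (Set.Ioc 0 1) := by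
    intro η hη
    simp only
    rw [← tsum_tiltedGaussian_div_of_im_ne ha V (w := w + η * I)]
    · simp only [add_right_comm w]
    · simpa [him] using hη.1.ne'
  have := heq.of_subset_closure hcL hcR Set.Ioc_subset_Icc_self
    (by rw [closure_Ioc zero_ne_one]) (Set.left_mem_Icc.2 zero_le_one)
  simpa using this

/-! ### The Poincaré series over ℤ + τℤ and its convergence. -/

/-- The factor `(-1)^r e^{πi(2m+1)r(z₁+z₂)} q^{(m+1/2)r²}`. -/
def thetaFactor (m : ℕ) (τ Z : ℂ) (r : ℤ) : ℂ :=
  (-1 : ℂ) ^ r * exp (Real.pi * I * (2 * m + 1) * (r * Z + r ^ 2 * τ))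

/-- The width of the Gaussians in the Poincaré series. -/
def gaussWidth (m : ℕ) (τ : ℂ) : ℝ := (2 * m + 1) / (2 * τ.im)

theorem gaussWidth_pos (m : ℕ) {τ : ℂ} (hτ : 0 < τ.im) : 0 < gaussWidth m τ := by
  unfold gaussWidth
  positivity

/-- The summand of the Poincaré series attached to the lattice point `p + rτ`. -/
def poincareTerm (m : ℕ) (τ z₁ z₂ : ℂ) (n : ℤ × ℤ) : ℂ :=
  thetaFactor m τ (z₁ + z₂) n.1 * ((-1 : ℂ) ^ n.2 *
    (tiltedGaussian (gaussWidth m τ) ((z₁ - z₂) / 2).im (z₁ + n.1 * τ + n.2) /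
      (z₁ + n.1 * τ + n.2)))

/-- An absolutely convergent sum over `ℤ + τℤ` of Gaussians with a simple pole. -/
def poincare (m : ℕ) (τ z₁ z₂ : ℂ) : ℂ := ∑' n : ℤ × ℤ, poincareTerm m τ z₁ z₂ n

theorem sq_add_sq_le_lattice_norm {T y : ℝ} (hy : 0 < y) (p r : ℝ) :
    (2 + (2 * T ^ 2 + 1) / y ^ 2)⁻¹ * (p ^ 2 + r ^ 2) ≤ (r * T + p) ^ 2 + y ^ 2 * r ^ 2 := by
  rw [inv_mul_le_iff₀ (by positivity)]
  have e : (2 + (2 * T ^ 2 + 1) / y ^ 2) * ((r * T + p) ^ 2 + y ^ 2 * r ^ 2) =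
      2 * (r * T + p) ^ 2 + 2 * y ^ 2 * r ^ 2 + (2 * T ^ 2 + 1) / y ^ 2 * (r * T + p) ^ 2 +
        (2 * T ^ 2 + 1) * r ^ 2 := by
    field_simp
    ring
  rw [e]
  have h1 : 0 ≤ (2 * T ^ 2 + 1) / y ^ 2 * (r * T + p) ^ 2 := by positivity
  have h2 : 0 ≤ 2 * y ^ 2 * r ^ 2 := by positivity
  nlinarith [sq_nonneg (2 * r * T + p)]

/-- The Gaussian alone contributes the indefinite form Re((rτ + p)²); the theta factor adds 2r²(Im
τ)² and completes it to |rτ + p|², which is positive definite by `sq_add_sq_le_lattice_norm`. -/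
theorem summable_norm_lattice_gaussian (m : ℕ) {τ : ℂ} (hτ : 0 < τ.im) (z Z : ℂ) (V : ℝ) :
    Summable fun n : ℤ × ℤ => ‖thetaFactor m τ Z n.1 *
      tiltedGaussian (gaussWidth m τ) V (z + n.1 * τ + n.2)‖ := by
  set a := gaussWidth m τ with ha_def
  have ha : 0 < a := gaussWidth_pos m hτ
  have hs : (2 * (m : ℝ) + 1) = 2 * a * τ.im := by
    rw [ha_def, gaussWidth]
    field_simp
  set c := (2 + (2 * τ.re ^ 2 + 1) / τ.im ^ 2)⁻¹ with hc_def
  have hc : 0 < Real.pi * a * c := by positivity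
  have h := (((summable_exp_quadratic hc (-Real.pi * a * (2 * z.re * τ.re - 2 * z.im * τ.im +
    4 * V * τ.im + 2 * τ.im * Z.im))).mul_of_nonneg (summable_exp_quadratic hc
      (-Real.pi * a * (2 * z.re))) (fun _ => (Real.exp_pos _).le)
        (fun _ => (Real.exp_pos _).le))).mul_left
    (Real.exp (-Real.pi * a * (z.re ^ 2 - z.im ^ 2 + 4 * V * z.im)))
  refine Summable.of_nonneg_of_le (fun n => norm_nonneg _) (fun n => ?_) h
  have hq := sq_add_sq_le_lattice_norm (T := τ.re) hτ n.2 n.1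
  rw [norm_mul, thetaFactor, norm_mul, norm_neg_one_zpow, one_mul, norm_exp, norm_tiltedGaussian,
    ← Real.exp_add, ← Real.exp_add, ← Real.exp_add]
  refine Real.exp_le_exp.2 ?_
  have e1 : (Real.pi * I * (2 * m + 1) * (n.1 * Z + n.1 ^ 2 * τ)).re =
      -Real.pi * (2 * m + 1) * (n.1 * Z.im + (n.1 : ℝ) ^ 2 * τ.im) := by
    have : (Real.pi * I * (2 * m + 1) * (n.1 * Z + n.1 ^ 2 * τ) : ℂ) =
      ((Real.pi * (2 * m + 1) : ℝ) : ℂ) * (I * (((n.1 : ℝ) : ℂ) * Z +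
        (((n.1 : ℝ) ^ 2 : ℝ) : ℂ) * τ)) := by
      push_cast
      ring
    rw [this, re_ofReal_mul, I_mul_re, add_im, im_ofReal_mul, im_ofReal_mul]
    ring
  rw [e1, hs]
  simp only [add_re, add_im, mul_re, mul_im, intCast_re, intCast_im]
  have hm := mul_le_mul_of_nonneg_left hq (by positivity : 0 ≤ Real.pi * a)
  rw [← hc_def] at hm
  nlinarith

theorem eventually_one_le_norm_lattice {τ : ℂ} (hτ : 0 < τ.im) (z : ℂ) :
    ∀ᶠ n : ℤ × ℤ in Filter.cofinite, 1 ≤ ‖z + n.1 * τ + n.2‖ := by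
  rw [Filter.eventually_cofinite]
  set A := ⌈(1 + ‖z‖) / τ.im⌉ with hA
  set B := ⌈1 + ‖z‖ + A * ‖τ‖⌉ with hB
  refine ((Set.finite_Icc (-A) A).prod (Set.finite_Icc (-B) B)).subset fun n hn => ?_
  simp only [Set.mem_ofPred_eq, not_le] at hn
  have h1 : |(n.1 : ℝ)| ≤ A := by
    refine le_trans ?_ (Int.le_ceil _)
    rw [le_div_iff₀ hτ]
    have h2 := abs_im_le_norm (z + n.1 * τ + n.2)
    have h3 := abs_im_le_norm z
    have h4 : (n.1 : ℝ) * τ.im = (z + n.1 * τ + n.2).im - z.im := by simp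
    have h5 : |(n.1 : ℝ)| * τ.im = |(n.1 : ℝ) * τ.im| := by rw [abs_mul, abs_of_pos hτ]
    rw [h5, h4]
    exact (abs_sub _ _).trans (by linarith)
  have h2 : |(n.2 : ℝ)| ≤ B := by
    refine le_trans ?_ (Int.le_ceil _)
    have h3 : (n.2 : ℂ) = (z + n.1 * τ + n.2) - z - n.1 * τ := by ring
    have h4 : ‖(n.2 : ℂ)‖ ≤ ‖z + n.1 * τ + n.2‖ + ‖z‖ + ‖(n.1 : ℂ) * τ‖ := by
      conv_lhs => rw [h3]
      exact (norm_sub_le _ _).trans (add_le_add_left (norm_sub_le _ _) _)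
    rw [norm_mul, norm_intCast, norm_intCast] at h4
    have h5 := mul_le_mul_of_nonneg_right h1 (norm_nonneg τ)
    linarith
  exact ⟨abs_le.1 (by exact_mod_cast h1), abs_le.1 (by exact_mod_cast h2)⟩

theorem summable_poincareTerm (m : ℕ) {τ : ℂ} (hτ : 0 < τ.im) (z₁ z₂ : ℂ) :
    Summable (poincareTerm m τ z₁ z₂) := by
  have h := Summable.div_of_eventually_one_le
    (summable_norm_lattice_gaussian m hτ z₁ (z₁ + z₂) ((z₁ - z₂) / 2).im)
    (eventually_one_le_norm_lattice hτ z₁)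
  refine Summable.of_norm (h.norm.congr fun n => ?_)
  rw [poincareTerm, mul_left_comm, norm_mul, norm_neg_one_zpow, one_mul, mul_div_assoc]

/-! ### Identification of Φ̃ with the antisymmetrized Poincaré series. -/

theorem hasSum_poincare_fiber (m : ℕ) {τ : ℂ} (hτ : 0 < τ.im) {z₁ : ℂ} (z₂ : ℂ)
    (hz : ∀ r p : ℤ, z₁ + r * τ + p ≠ 0) :
    HasSum (fun r : ℤ => thetaFactor m τ (z₁ + z₂) r * (I / 2 / sin (Real.pi * (z₁ + r * τ))) +
      thetaFactor m τ (z₁ + z₂) r *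
        ∑' n : ℤ, errorTerm (gaussWidth m τ) ((z₁ - z₂) / 2).im (z₁ + r * τ) n)
      (I / (2 * Real.pi) * poincare m τ z₁ z₂) := by
  have hs := summable_poincareTerm m hτ z₁ z₂
  have h := hs.hasSum.prod_fiberwise fun r => (hs.prod_factor r).hasSum
  refine (h.mul_left (I / (2 * Real.pi))).congr_fun fun r => ?_
  simp only [poincareTerm]
  rw [tsum_mul_left, mul_left_comm, tsum_tiltedGaussian_div (gaussWidth_pos m hτ) _ (hz r)]
  ring

theorem Phi1_eq_tsum (m : ℕ) (τ z₁ z₂ t : ℂ) (hz : ∀ r p : ℤ, z₁ + r * τ + p ≠ 0) :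
    Phi1 m τ z₁ z₂ t = exp (2 * Real.pi * I * (m + 1 / 2) * t) *
      ∑' r : ℤ, thetaFactor m τ (z₁ + z₂) r * (I / 2 / sin (Real.pi * (z₁ + r * τ))) := by
  rw [Phi1]
  congr 1
  refine tsum_congr fun r => ?_
  have hne : exp (2 * Real.pi * I * (z₁ + r * τ)) ≠ 1 := by
    intro h
    obtain ⟨k, hk⟩ := exp_eq_one_iff.1 h
    refine hz r (-k) ?_
    have h2 : (2 * Real.pi * I : ℂ) ≠ 0 := two_pi_I_ne_zero
    have h3 : z₁ + r * τ = k := mul_left_cancel₀ h2 (by rw [hk]; ring)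
    rw [h3]
    simp
  have e1 : exp (Real.pi * I * r * (2 * m + 1) * (z₁ + z₂) + Real.pi * I * z₁) *
      qpow τ ((m + 1 / 2) * (r : ℂ) ^ 2 + r / 2) =
      exp (Real.pi * I * (2 * m + 1) * (r * (z₁ + z₂) + r ^ 2 * τ)) *
        exp (Real.pi * I * (z₁ + r * τ)) := by
    rw [qpow, ← exp_add, ← exp_add]
    congr 1
    ring
  have e2 : exp (2 * Real.pi * I * z₁) * qpow τ r = exp (2 * Real.pi * I * (z₁ + r * τ)) := by
    rw [qpow, ← exp_add]
    congr 1
    ring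
  rw [← exp_geometric_eq_inv_sin hne, thetaFactor, e1, e2, div_eq_mul_inv]
  ring

theorem natCast_eq_emod_iff (s : ℕ) (hs : 0 < s) (N : ℤ) (j : ℕ) (hj : j < s) :
    (j : ℤ) = N % s ↔ ∃ l : ℤ, N = j + s * l := by
  have hs' : (0 : ℤ) < s := by exact_mod_cast hs
  constructor
  · intro h
    exact ⟨N / s, by rw [h]; exact (Int.emod_add_mul_ediv N s).symm⟩
  · rintro ⟨l, rfl⟩
    rw [Int.add_mul_emod_self_left, Int.emod_eq_of_lt (by positivity) (by exact_mod_cast hj)]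

/-- Sums over `ℤ × ℤ` split according to the residue of the second coordinate. -/
theorem hasSum_of_residues {s : ℕ} (hs : 0 < s) {F : ℤ × ℤ → ℂ} {c : ℕ → ℂ}
    (h : ∀ j < s, HasSum (fun q : ℤ × ℤ => F (q.2 + q.1, j + s * q.1)) (c j)) :
    HasSum F (∑ j ∈ Finset.range s, c j) := by
  have hs' : (0 : ℤ) < s := by exact_mod_cast hs
  have h1 : ∀ j ∈ Finset.range s,
      HasSum (fun n : ℤ × ℤ => if (j : ℤ) = n.2 % s then F n else 0) (c j) := by
    intro j hj
    have hj := Finset.mem_range.1 hj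
    have hinj : Function.Injective
        (fun q : ℤ × ℤ => ((q.2 + q.1, (j : ℤ) + s * q.1) : ℤ × ℤ)) := by
      rintro ⟨l, r⟩ ⟨l', r'⟩ hq
      simp only [Prod.mk.injEq, add_right_inj, mul_eq_mul_left_iff, hs'.ne', or_false] at hq
      obtain ⟨h1, rfl⟩ := hq
      simpa using h1
    refine (hinj.hasSum_iff ?_).1 ((h j hj).congr_fun fun q => ?_)
    · rintro ⟨r, N⟩ hx
      refine if_neg fun hN => hx ?_
      obtain ⟨l, rfl⟩ := (natCast_eq_emod_iff s hs N j hj).1 hN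
      exact ⟨(l, r - l), by simp⟩
    · exact if_pos ((natCast_eq_emod_iff s hs _ j hj).2 ⟨q.1, rfl⟩)
  refine (hasSum_sum h1).congr_fun fun n => ?_
  have h0 := Int.emod_nonneg n.2 hs'.ne'
  have h2 := Int.emod_lt_of_pos n.2 hs'
  obtain ⟨k, hk⟩ := Int.eq_ofNat_of_zero_le h0
  rw [hk] at h2 ⊢
  simp only [Nat.cast_inj]
  rw [Finset.sum_ite_eq' (Finset.range s) k, if_pos (Finset.mem_range.2 (by exact_mod_cast h2))]

theorem RBterm_eq (m : ℕ) {τ : ℂ} (hτ : 0 < τ.im) (v : ℂ) (ν : ℝ) :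
    RBterm m τ v ν = ((Real.sign ν -
      gaussE ((ν + 2 * gaussWidth m τ * v.im) / √(gaussWidth m τ)) : ℝ) : ℂ) *
    exp (-(Real.pi * I * (ν : ℂ) ^ 2 * τ / (2 * m + 1)) - 2 * Real.pi * I * ν * v) := by
  have e1 : τ.im / ((m : ℝ) + 1 / 2) = (gaussWidth m τ)⁻¹ := by
    rw [gaussWidth]
    field_simp
  have e2 : (2 * (m : ℝ) + 1) * (v.im / τ.im) = 2 * gaussWidth m τ * v.im := by
    rw [gaussWidth]
    field_simp
  rw [RBterm, e1, e2, Real.sqrt_inv, ← div_eq_mul_inv]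

/-- The exponential factor grows exactly like exp(πν²/(2a)) with a = `gaussWidth m τ`, the growth
that sgn - E beats. -/
theorem summable_RBterm (m : ℕ) {τ : ℂ} (hτ : 0 < τ.im) (v : ℂ) :
    Summable fun N : ℤ => ‖RBterm m τ v (N + 1 / 2)‖ := by
  refine (summable_sign_sub_gaussE_mul_exp (gaussWidth_pos m hτ) v.im
    (2 * Real.pi * v.im)).congr fun N => ?_
  rw [RBterm_eq m hτ, norm_mul, norm_real, Real.norm_eq_abs, norm_exp]
  congr 2
  have e : (-(Real.pi * I * (((N : ℝ) + 1 / 2 : ℝ) : ℂ) ^ 2 * τ / (2 * m + 1)) -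
      2 * Real.pi * I * (((N : ℝ) + 1 / 2 : ℝ) : ℂ) * v) =
      ((-(Real.pi * ((N : ℝ) + 1 / 2) ^ 2 / (2 * m + 1)) : ℝ) : ℂ) * (I * τ) +
        ((-(2 * Real.pi * ((N : ℝ) + 1 / 2)) : ℝ) : ℂ) * (I * v) := by
    push_cast
    ring
  rw [e, add_re, re_ofReal_mul, re_ofReal_mul, I_mul_re, I_mul_re, gaussWidth]
  field_simp

/-- The summand of `Θ⁻_{j,d}(τ, z)`. -/
def thetaMinusTerm (j d : ℝ) (τ z : ℂ) (n : ℤ) : ℂ :=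
  (-1 : ℂ) ^ n * (exp (2 * Real.pi * I * d * z * (n + j / (2 * d))) *
    qpow τ (d * ((n : ℂ) + j / (2 * d)) ^ 2))

theorem summable_norm_thetaMinusTerm (j : ℝ) {d : ℝ} (hd : 0 < d) {τ : ℂ} (hτ : 0 < τ.im) (z : ℂ) :
    Summable fun n : ℤ => ‖thetaMinusTerm j d τ z n‖ := by
  refine ((summable_exp_quadratic (c := 2 * Real.pi * d * τ.im) (by positivity)
    (-(2 * Real.pi * d * z.im) - 2 * Real.pi * j * τ.im)).mul_left
      (Real.exp (-Real.pi * j * z.im - Real.pi * j ^ 2 * τ.im / (2 * d)))).congr fun n => ?_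
  rw [thetaMinusTerm, norm_mul, norm_neg_one_zpow, one_mul, qpow, ← exp_add, norm_exp,
    ← Real.exp_add]
  congr 1
  have e : 2 * (Real.pi : ℂ) * I * d * z * (n + j / (2 * d)) +
      2 * Real.pi * I * τ * (d * ((n : ℂ) + j / (2 * d)) ^ 2) =
      ((2 * Real.pi * d * (n + j / (2 * d)) : ℝ) : ℂ) * (I * z) +
        ((2 * Real.pi * (d * ((n : ℝ) + j / (2 * d)) ^ 2) : ℝ) : ℂ) * (I * τ) := by
    push_cast
    ring
  rw [e, add_re, re_ofReal_mul, re_ofReal_mul, I_mul_re, I_mul_re]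
  field_simp
  ring

theorem neg_one_zpow_odd_mul (m : ℕ) (l : ℤ) :
    (-1 : ℂ) ^ ((2 * (m : ℤ) + 1) * l) = (-1 : ℂ) ^ l := by
  rw [zpow_mul, Odd.neg_one_zpow ⟨m, rfl⟩]

/-- With ν = j + 1/2 + (2m+1)l, the theta index is r - (j + 1/2)/(2m+1) = (r + l) - ν/(2m+1).
Expanding its square, the ν² term cancels the exponential of the R summand, and the row r + l
appears. -/
theorem RBterm_mul_thetaMinusTerm (m : ℕ) {τ : ℂ} (hτ : 0 < τ.im) (z₁ z₂ : ℂ) (j : ℕ) (l r : ℤ) :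
    (-1 : ℂ) ^ ((2 * (m : ℤ) + 1) * l) *
        RBterm m τ ((z₁ - z₂) / 2) ((j : ℝ) + 1 / 2 + (2 * m + 1) * l) *
        thetaMinusTerm (-((j : ℝ) + 1 / 2)) ((m : ℝ) + 1 / 2) τ (z₁ + z₂) r =
      2 * (thetaFactor m τ (z₁ + z₂) (r + l) * errorTerm (gaussWidth m τ) ((z₁ - z₂) / 2).im
        (z₁ + ((r + l : ℤ) : ℂ) * τ) (j + ((2 * m + 1 : ℕ) : ℤ) * l)) := by
  have e : (((j + ((2 * m + 1 : ℕ) : ℤ) * l : ℤ) : ℝ) + 1 / 2) =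
      (j : ℝ) + 1 / 2 + (2 * m + 1) * l := by
    push_cast
    ring
  have hs : (2 * (m : ℂ) + 1) ≠ 0 := by exact_mod_cast (2 * m).succ_ne_zero
  rw [RBterm_eq m hτ, neg_one_zpow_odd_mul, thetaMinusTerm, thetaFactor, errorTerm, e,
    zpow_add₀ (by norm_num), qpow]
  have h : exp (-(Real.pi * I * (((j : ℝ) + 1 / 2 + (2 * m + 1) * l : ℝ) : ℂ) ^ 2 * τ / (2 * m + 1)) -
        2 * Real.pi * I * (((j : ℝ) + 1 / 2 + (2 * m + 1) * l : ℝ) : ℂ) * ((z₁ - z₂) / 2)) *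
      (exp (2 * Real.pi * I * (((m : ℝ) + 1 / 2 : ℝ) : ℂ) * (z₁ + z₂) * (r +
        ((-((j : ℝ) + 1 / 2) : ℝ) : ℂ) / (2 * (((m : ℝ) + 1 / 2 : ℝ) : ℂ)))) *
      exp (2 * Real.pi * I * τ * ((((m : ℝ) + 1 / 2 : ℝ) : ℂ) * ((r : ℂ) +
        ((-((j : ℝ) + 1 / 2) : ℝ) : ℂ) / (2 * (((m : ℝ) + 1 / 2 : ℝ) : ℂ))) ^ 2))) =
      exp (Real.pi * I * (2 * m + 1) * (((r + l : ℤ) : ℂ) * (z₁ + z₂) + ((r + l : ℤ) : ℂ) ^ 2 * τ)) *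
      exp (-2 * Real.pi * I * (((j + ((2 * m + 1 : ℕ) : ℤ) * l : ℤ) : ℂ) + 1 / 2) *
        (z₁ + ((r + l : ℤ) : ℂ) * τ)) := by
    rw [← exp_add, ← exp_add, ← exp_add]
    congr 1
    push_cast
    have hs2 : 2 * ((m : ℂ) + 1 / 2) = 2 * m + 1 := by ring
    rw [hs2]
    field_simp
    ring
  linear_combination ((Real.sign ((j : ℝ) + 1 / 2 + (2 * m + 1) * l) - gaussE
    (((j : ℝ) + 1 / 2 + (2 * m + 1) * l + 2 * gaussWidth m τ * ((z₁ - z₂) / 2).im) /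
      √(gaussWidth m τ)) : ℝ) : ℂ) * (-1 : ℂ) ^ l * (-1 : ℂ) ^ r * h

theorem hasSum_errorTerm (m : ℕ) {τ : ℂ} (hτ : 0 < τ.im) (z₁ z₂ : ℂ) :
    HasSum (fun n : ℤ × ℤ => thetaFactor m τ (z₁ + z₂) n.1 *
        errorTerm (gaussWidth m τ) ((z₁ - z₂) / 2).im (z₁ + n.1 * τ) n.2)
      (∑ j ∈ Finset.range (2 * m + 1), 1 / 2 * (RB j m τ ((z₁ - z₂) / 2) *
        ThetaMinus (-((j : ℝ) + 1 / 2)) ((m : ℝ) + 1 / 2) τ (z₁ + z₂))) := by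
  refine hasSum_of_residues (Nat.succ_pos _) fun j _ => ?_
  have hR : Summable fun l : ℤ => ‖(-1 : ℂ) ^ ((2 * (m : ℤ) + 1) * l) *
      RBterm m τ ((z₁ - z₂) / 2) ((j : ℝ) + 1 / 2 + (2 * m + 1) * l)‖ := by
    have hinj : Function.Injective fun l : ℤ => (j : ℤ) + (2 * m + 1) * l := by
      intro l l' h
      have h0 : (2 * (m : ℤ) + 1) ≠ 0 := by positivity
      simpa [h0] using h
    refine ((summable_RBterm m hτ ((z₁ - z₂) / 2)).comp_injective hinj).congr fun l => ?_
    rw [norm_mul, norm_neg_one_zpow, one_mul]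
    simp only [Function.comp]
    congr 2
    push_cast
    ring
  have hT := summable_norm_thetaMinusTerm (-((j : ℝ) + 1 / 2)) (d := (m : ℝ) + 1 / 2)
    (by positivity) hτ (z₁ + z₂)
  have h := (summable_mul_of_summable_norm hR hT).hasSum
  rw [← tsum_mul_tsum_of_summable_norm hR hT] at h
  refine (h.mul_left (1 / 2)).congr_fun fun q => ?_
  rw [RBterm_mul_thetaMinusTerm m hτ]
  ring

/-- Only the Θ⁻ with negative index is needed to complete Φ₁(z₁, z₂); the other half of the added
term serves Φ₁(z₂, z₁). -/
theorem Phi1_add_correction (m : ℕ) {τ : ℂ} (hτ : 0 < τ.im) {z₁ : ℂ} (z₂ t : ℂ)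
    (hz : ∀ r p : ℤ, z₁ + r * τ + p ≠ 0) :
    Phi1 m τ z₁ z₂ t + exp (2 * Real.pi * I * (m + 1 / 2) * t) *
      ∑ j ∈ Finset.range (2 * m + 1), 1 / 2 * (RB j m τ ((z₁ - z₂) / 2) *
        ThetaMinus (-((j : ℝ) + 1 / 2)) ((m : ℝ) + 1 / 2) τ (z₁ + z₂)) =
      exp (2 * Real.pi * I * (m + 1 / 2) * t) * (I / (2 * Real.pi) * poincare m τ z₁ z₂) := by
  have hE := hasSum_errorTerm m hτ z₁ z₂
  have hE' := hE.prod_fiberwise fun r =>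
    ((summable_errorTerm (gaussWidth_pos m hτ) ((z₁ - z₂) / 2).im (z₁ + r * τ)).hasSum).mul_left
      (thetaFactor m τ (z₁ + z₂) r)
  have h := (hasSum_poincare_fiber m hτ z₂ hz).sub hE'
  simp only [add_sub_cancel_right] at h
  rw [Phi1_eq_tsum m τ z₁ z₂ t hz, h.tsum_eq]
  ring

theorem RBterm_neg (m : ℕ) {τ : ℂ} (hτ : 0 < τ.im) (v : ℂ) (ν : ℝ) :
    RBterm m τ (-v) (-ν) = -RBterm m τ v ν := by
  rw [RBterm_eq m hτ, RBterm_eq m hτ, Real.sign_neg, neg_im]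
  have e : (-ν + 2 * gaussWidth m τ * -v.im) / √(gaussWidth m τ) =
      -((ν + 2 * gaussWidth m τ * v.im) / √(gaussWidth m τ)) := by ring
  rw [e, gaussE_neg]
  push_cast
  ring_nf

/-- The residues j + 1/2 and -(j + 1/2) are exchanged by j ↦ 2m - j. The index is written in the
shape that `Finset.sum_range_reflect` produces. -/
theorem RB_reflect {m j : ℕ} (hj : j < 2 * m + 1) {τ : ℂ} (hτ : 0 < τ.im) (v : ℂ) :
    RB (2 * m + 1 - 1 - j) m τ v = RB j m τ (-v) := by
  rw [RB, RB, ← (Equiv.subLeft (-1 : ℤ)).tsum_eq]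
  refine tsum_congr fun l => ?_
  have e : (((2 * m + 1 - 1 - j : ℕ) : ℝ) + 1 / 2 + (2 * m + 1) * ((Equiv.subLeft (-1 : ℤ) l : ℤ) : ℝ)) =
      -((j : ℝ) + 1 / 2 + (2 * m + 1) * l) := by
    rw [Nat.add_sub_cancel, Nat.cast_sub (by omega), Equiv.subLeft_apply]
    push_cast
    ring
  rw [e, ← neg_neg v, RBterm_neg m hτ, neg_neg, neg_one_zpow_odd_mul, neg_one_zpow_odd_mul,
    Equiv.subLeft_apply, zpow_sub₀ (by norm_num), div_eq_mul_inv, ← inv_zpow, inv_neg, inv_one,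
    zpow_neg_one, inv_neg, inv_one]
  ring

theorem ThetaMinus_reflect {m j : ℕ} (hj : j < 2 * m + 1) (τ z : ℂ) :
    ThetaMinus (((2 * m + 1 - 1 - j : ℕ) : ℝ) + 1 / 2) ((m : ℝ) + 1 / 2) τ z =
      -ThetaMinus (-((j : ℝ) + 1 / 2)) ((m : ℝ) + 1 / 2) τ z := by
  rw [ThetaMinus, ThetaMinus, ← (Equiv.subRight (1 : ℤ)).tsum_eq, ← tsum_neg]
  refine tsum_congr fun n => ?_
  have hs : (2 * m + 1 : ℂ) ≠ 0 := by exact_mod_cast (2 * m).succ_ne_zero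
  have hs2 : 2 * ((m : ℂ) + 1 / 2) = 2 * m + 1 := by ring
  have e : (((Equiv.subRight (1 : ℤ) n : ℤ) : ℂ) +
      (((((2 * m + 1 - 1 - j : ℕ) : ℝ) + 1 / 2 : ℝ)) : ℂ) / (2 * (((m : ℝ) + 1 / 2 : ℝ) : ℂ))) =
      (n : ℂ) + ((-((j : ℝ) + 1 / 2) : ℝ) : ℂ) / (2 * (((m : ℝ) + 1 / 2 : ℝ) : ℂ)) := by
    rw [Nat.add_sub_cancel, Nat.cast_sub (by omega), Equiv.subRight_apply]
    push_cast
    rw [hs2]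
    field_simp
    ring
  rw [e, Equiv.subRight_apply, zpow_sub_one₀ (by norm_num), inv_neg, inv_one]
  ring

/-- `Φ̃^{[B;m]}` is an antisymmetrized Poincaré series. -/
theorem PhiTilde_eq_poincare (m : ℕ) {τ : ℂ} (hτ : 0 < τ.im) {z₁ z₂ : ℂ} (t : ℂ)
    (hz₁ : ∀ r p : ℤ, z₁ + r * τ + p ≠ 0) (hz₂ : ∀ r p : ℤ, z₂ + r * τ + p ≠ 0) :
    PhiTilde m τ z₁ z₂ t = I / (2 * Real.pi) * exp (Real.pi * I * (2 * m + 1) * t) *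
      (poincare m τ z₁ z₂ - poincare m τ z₂ z₁) := by
  have h1 := Phi1_add_correction m hτ z₂ t hz₁
  have h2 := Phi1_add_correction m hτ z₁ t hz₂
  -- Reflecting j turns the positive-index half of the added term into minus the correction of Φ₁
  -- with its arguments exchanged.
  have h3 : ∑ j ∈ Finset.range (2 * m + 1), 1 / 2 * (RB j m τ ((z₁ - z₂) / 2) *
        ThetaMinus ((j : ℝ) + 1 / 2) ((m : ℝ) + 1 / 2) τ (z₁ + z₂)) =
      -∑ j ∈ Finset.range (2 * m + 1), 1 / 2 * (RB j m τ ((z₂ - z₁) / 2) *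
        ThetaMinus (-((j : ℝ) + 1 / 2)) ((m : ℝ) + 1 / 2) τ (z₂ + z₁)) := by
    rw [← Finset.sum_range_reflect, ← Finset.sum_neg_distrib]
    refine Finset.sum_congr rfl fun j hj => ?_
    have hj := Finset.mem_range.1 hj
    rw [RB_reflect hj hτ, ThetaMinus_reflect hj, show -((z₁ - z₂) / 2) = (z₂ - z₁) / 2 by ring,
      add_comm z₁ z₂]
    ring
  have h4 : PhiAdd m τ z₁ z₂ t = exp (2 * Real.pi * I * (m + 1 / 2) * t) *
      (∑ j ∈ Finset.range (2 * m + 1), 1 / 2 * (RB j m τ ((z₁ - z₂) / 2) *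
        ThetaMinus ((j : ℝ) + 1 / 2) ((m : ℝ) + 1 / 2) τ (z₁ + z₂)) +
      ∑ j ∈ Finset.range (2 * m + 1), 1 / 2 * (RB j m τ ((z₁ - z₂) / 2) *
        ThetaMinus (-((j : ℝ) + 1 / 2)) ((m : ℝ) + 1 / 2) τ (z₁ + z₂))) := by
    rw [PhiAdd, ← Finset.sum_add_distrib, Finset.mul_sum, Finset.mul_sum]
    refine Finset.sum_congr rfl fun j _ => ?_
    ring
  rw [PhiTilde, Phi, h4, h3, show (Real.pi * I * (2 * m + 1) * t : ℂ) =
    2 * Real.pi * I * (m + 1 / 2) * t by ring]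
  linear_combination h1 - h2

/-! ### Behaviour of the Poincaré series under translations and inversion. -/

theorem neg_one_zpow_congr {a b : ℤ} (h : Even (a - b)) : (-1 : ℂ) ^ a = (-1 : ℂ) ^ b := by
  have h1 : (-1 : ℂ) ^ (a - b) = 1 := h.neg_one_zpow
  rw [zpow_sub₀ (by norm_num), div_eq_one_iff_eq (zpow_ne_zero _ (by norm_num))] at h1
  exact h1

theorem even_odd_mul_sq_mul_sub (m : ℕ) (r N : ℤ) : Even ((2 * m + 1) * r ^ 2 * N - r * N) := by
  have h := Int.even_mul_pred_self r
  obtain ⟨k, hk⟩ := h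
  refine ⟨m * r ^ 2 * N + k * N, ?_⟩
  linear_combination N * hk

/-- The width sees only Im τ. The theta factor gains (-1)^{(2m+1)r²N} = (-1)^{rN}, exactly the sign
caused by p ↦ p + rN. -/
theorem poincareTerm_add_int (m : ℕ) (τ z₁ z₂ : ℂ) (N r p : ℤ) :
    poincareTerm m (τ + N) z₁ z₂ (r, p) = poincareTerm m τ z₁ z₂ (r, p + r * N) := by
  have e1 : gaussWidth m (τ + N) = gaussWidth m τ := by simp [gaussWidth]
  have e2 : z₁ + r * (τ + N) + p = z₁ + r * τ + ((p + r * N : ℤ) : ℂ) := by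
    push_cast
    ring
  have e3 : thetaFactor m (τ + N) (z₁ + z₂) r =
      thetaFactor m τ (z₁ + z₂) r * (-1 : ℂ) ^ (r * N) := by
    rw [thetaFactor, thetaFactor, ← neg_one_zpow_congr (even_odd_mul_sq_mul_sub m r N),
      neg_one_zpow_eq_exp (_ * N), mul_assoc ((-1 : ℂ) ^ r), ← exp_add]
    congr 2
    push_cast
    ring
  simp only [poincareTerm, e1, e2, e3]
  rw [zpow_add₀ (by norm_num) p]
  ring

theorem poincare_add_int (m : ℕ) (τ z₁ z₂ : ℂ) (N : ℤ) :
    poincare m (τ + N) z₁ z₂ = poincare m τ z₁ z₂ := by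
  let e : ℤ × ℤ ≃ ℤ × ℤ := Equiv.prodShear (Equiv.refl ℤ) fun r => Equiv.addRight (r * N)
  rw [poincare, poincare, ← e.tsum_eq (poincareTerm m τ z₁ z₂)]
  exact tsum_congr fun n => poincareTerm_add_int m τ z₁ z₂ N n.1 n.2

theorem poincareTerm_shift (m : ℕ) (τ z₁ z₂ : ℂ) {n₁ n₂ : ℤ} (h : Even (n₁ - n₂)) (r p : ℤ) :
    poincareTerm m τ (z₁ + n₁) (z₂ + n₂) (r, p) =
      (-1 : ℂ) ^ n₁ * poincareTerm m τ z₁ z₂ (r, p + n₁) := by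
  have e1 : ((z₁ + n₁ - (z₂ + n₂)) / 2).im = ((z₁ - z₂) / 2).im := by
    simp
  have e2 : z₁ + n₁ + r * τ + p = z₁ + r * τ + ((p + n₁ : ℤ) : ℂ) := by
    push_cast
    ring
  have e3 : thetaFactor m τ (z₁ + n₁ + (z₂ + n₂)) r = thetaFactor m τ (z₁ + z₂) r := by
    obtain ⟨k, hk⟩ := h
    rw [thetaFactor, thetaFactor]
    have : Real.pi * I * (2 * m + 1) * (r * (z₁ + n₁ + (z₂ + n₂)) + r ^ 2 * τ) =
        Real.pi * I * (2 * m + 1) * (r * (z₁ + z₂) + r ^ 2 * τ) +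
          (((2 * m + 1) * r * (n₂ + k) : ℤ) : ℂ) * (2 * Real.pi * I) := by
      have hk' : (n₁ : ℂ) = n₂ + k + k := by
        have : n₁ = n₂ + k + k := by omega
        exact_mod_cast this
      rw [hk']
      push_cast
      ring
    rw [this, exp_add, exp_int_mul_two_pi_mul_I, mul_one]
  have e4 : (-1 : ℂ) ^ p = (-1 : ℂ) ^ n₁ * (-1 : ℂ) ^ (p + n₁) := by
    rw [← zpow_add₀ (by norm_num)]
    exact neg_one_zpow_congr ⟨-n₁, by ring⟩
  simp only [poincareTerm, e1, e2, e3, e4]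
  ring

theorem poincare_shift (m : ℕ) (τ z₁ z₂ : ℂ) {n₁ n₂ : ℤ} (h : Even (n₁ - n₂)) :
    poincare m τ (z₁ + n₁) (z₂ + n₂) = (-1 : ℂ) ^ n₁ * poincare m τ z₁ z₂ := by
  let e : ℤ × ℤ ≃ ℤ × ℤ := Equiv.prodShear (Equiv.refl ℤ) fun _ => Equiv.addRight n₁
  rw [poincare, poincare, ← e.tsum_eq (poincareTerm m τ z₁ z₂), ← tsum_mul_left]
  exact tsum_congr fun n => poincareTerm_shift m τ z₁ z₂ h n.1 n.2

/-- Imaginary parts are rewritten through complex conjugates so that, under τ ↦ -1/τ, the exponent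
is a rational identity with the conjugates as independent variables. -/
theorem tiltedGaussian_eq_conj (m : ℕ) (τ D x : ℂ) :
    tiltedGaussian (gaussWidth m τ) (D / 2).im x =
      exp (-Real.pi * ((2 * m + 1) * I / (τ - (starRingEnd ℂ) τ)) *
        (x ^ 2 - (D - (starRingEnd ℂ) D) * x)) := by
  rw [tiltedGaussian, sub_conj, sub_conj, gaussWidth]
  congr 1
  have e : (D / 2).im = D.im / 2 := by simp
  rw [e]
  push_cast
  have h1 : ((2 * (m : ℂ) + 1) / (2 * (τ.im : ℂ))) =
      (2 * m + 1) * I / (2 * (τ.im : ℂ) * I) := by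
    rw [mul_div_mul_right _ _ I_ne_zero]
  rw [h1]
  ring

theorem conj_sub_ne_zero {τ : ℂ} (hτ : 0 < τ.im) : τ - (starRingEnd ℂ) τ ≠ 0 := by
  rw [sub_conj]
  refine mul_ne_zero ?_ I_ne_zero
  exact_mod_cast (mul_pos two_pos hτ).ne'

/-- Since z₁/τ - r/τ + p = (z₁ + pτ - r)/τ, the point (r, p) goes to (p, -r); the pole gives the
factor τ, and the sign is symmetric in r and p. The remaining phase e^{-2πi(2m+1)pr} is 1. -/
theorem poincareTerm_neg_inv (m : ℕ) {τ : ℂ} (hτ : 0 < τ.im) (z₁ z₂ : ℂ) (r p : ℤ) :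
    exp (-(Real.pi * I * (2 * m + 1) * (z₁ * z₂ / τ))) *
        poincareTerm m (-1 / τ) (z₁ / τ) (z₂ / τ) (r, p) =
      τ * poincareTerm m τ z₁ z₂ (p, -r) := by
  have h0 : τ ≠ 0 := by
    rintro rfl
    simp at hτ
  have h0' : (starRingEnd ℂ) τ ≠ 0 := by simpa using h0
  have hd := conj_sub_ne_zero hτ
  have hd' : -1 / τ - (starRingEnd ℂ) (-1 / τ) =
      (τ - (starRingEnd ℂ) τ) / (τ * (starRingEnd ℂ) τ) := by
    rw [map_div₀, map_neg, map_one]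
    field_simp
    ring
  have e1 : z₁ / τ + r * (-1 / τ) + p = (z₁ + p * τ + ((-r : ℤ) : ℂ)) / τ := by
    push_cast
    field_simp
    ring
  have e2 : z₁ / τ - z₂ / τ = (z₁ - z₂) / τ := by ring
  simp only [poincareTerm, thetaFactor]
  rw [e1, e2, tiltedGaussian_eq_conj, tiltedGaussian_eq_conj, hd', map_div₀]
  set T := (starRingEnd ℂ) τ
  set D := (starRingEnd ℂ) (z₁ - z₂)
  set x := z₁ + p * τ + ((-r : ℤ) : ℂ) with hx
  have e3 : exp (-(Real.pi * I * (2 * m + 1) * (z₁ * z₂ / τ))) *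
      (exp (Real.pi * I * (2 * m + 1) * (r * (z₁ / τ + z₂ / τ) + r ^ 2 * (-1 / τ))) *
        exp (-Real.pi * ((2 * m + 1) * I / ((τ - T) / (τ * T))) *
          ((x / τ) ^ 2 - ((z₁ - z₂) / τ - D / T) * (x / τ)))) =
      exp (Real.pi * I * (2 * m + 1) * (p * (z₁ + z₂) + p ^ 2 * τ)) *
        exp (-Real.pi * ((2 * m + 1) * I / (τ - T)) * (x ^ 2 - (z₁ - z₂ - D) * x)) := by
    rw [← exp_add, ← exp_add, ← exp_add]
    have : -(Real.pi * I * (2 * m + 1) * (z₁ * z₂ / τ)) +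
        (Real.pi * I * (2 * m + 1) * (r * (z₁ / τ + z₂ / τ) + r ^ 2 * (-1 / τ)) +
        -Real.pi * ((2 * m + 1) * I / ((τ - T) / (τ * T))) *
          ((x / τ) ^ 2 - ((z₁ - z₂) / τ - D / T) * (x / τ))) =
        Real.pi * I * (2 * m + 1) * (p * (z₁ + z₂) + p ^ 2 * τ) +
        -Real.pi * ((2 * m + 1) * I / (τ - T)) * (x ^ 2 - (z₁ - z₂ - D) * x) +
        ((-(2 * m + 1) * p * r : ℤ) : ℂ) * (2 * Real.pi * I) := by
      rw [hx]
      push_cast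
      field_simp
      ring
    rw [this, exp_add _ (_ * (2 * Real.pi * I)), exp_int_mul_two_pi_mul_I, mul_one]
  have e4 : (-1 : ℂ) ^ (-r) = (-1 : ℂ) ^ r := neg_one_zpow_congr ⟨-r, by ring⟩
  rw [e4]
  have e5 : ∀ g : ℂ, g / (x / τ) = τ * (g / x) := fun g => by
    rw [div_div_eq_mul_div]
    ring
  rw [e5]
  linear_combination (-1 : ℂ) ^ r * (-1 : ℂ) ^ p * τ * x⁻¹ * e3

theorem poincare_neg_inv (m : ℕ) {τ : ℂ} (hτ : 0 < τ.im) (z₁ z₂ : ℂ) :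
    exp (-(Real.pi * I * (2 * m + 1) * (z₁ * z₂ / τ))) * poincare m (-1 / τ) (z₁ / τ) (z₂ / τ) =
      τ * poincare m τ z₁ z₂ := by
  let e : ℤ × ℤ ≃ ℤ × ℤ := (Equiv.prodComm ℤ ℤ).trans ((Equiv.refl ℤ).prodCongr (Equiv.neg ℤ))
  rw [poincare, poincare, ← e.tsum_eq (poincareTerm m τ z₁ z₂), ← tsum_mul_left, ← tsum_mul_left]
  exact tsum_congr fun n => poincareTerm_neg_inv m hτ z₁ z₂ n.1 n.2

/-! ### Comparison of the lattice sums at τ/M and Mτ by finite Fourier analysis. -/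

/-- The common summand of the lattice sums at `τ / M` and at `Mτ`. -/
def levelKernel (M m : ℕ) (τ z₁ z₂ α β : ℂ) : ℂ :=
  exp (Real.pi * I * (2 * m + 1) / M * (β * (z₁ + z₂) + β ^ 2 * τ)) *
    (tiltedGaussian (gaussWidth m (M * τ)) ((z₁ - z₂) / 2).im (z₁ + α + β * τ) /
      (z₁ + α + β * τ))

/-- The summand `levelKernel` at `(ε' + P, ε + b)` with the sign and phase common to all levels. -/
def levelTerm (M m : ℕ) (ε ε' j k τ z₁ z₂ : ℂ) (b P : ℤ) : ℂ :=
  (-1 : ℂ) ^ b * exp (-(Real.pi * I * (2 * m + 1) / M * ((ε + b) * (j + k)))) *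
    levelKernel M m τ z₁ z₂ (ε' + P) (ε + b)

theorem poincareTerm_div_level {M : ℕ} (hM : 1 ≤ M) (m : ℕ) {τ : ℂ} (hτ : 0 < τ.im) (z₁ z₂ : ℂ)
    (ε : ℂ) {ε' : ℝ} {e J K : ℤ} (he : 2 * ε' = e) (r p : ℤ) :
    exp (Real.pi * I * (2 * m + 1) / M *
        (ε * (z₁ + z₂ - (ε' + J) - (ε' + K)) + ε ^ 2 * τ)) *
      poincareTerm m (τ / M) ((z₁ - (ε' + J) + ε * τ) / M) ((z₂ - (ε' + K) + ε * τ) / M) (r, p) =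
    M * ((-1 : ℂ) ^ p * levelTerm M m ε ε' (ε' + J) (ε' + K) τ z₁ z₂ r (M * p - e - J)) := by
  have hM0 : (M : ℂ) ≠ 0 := by exact_mod_cast (by omega : M ≠ 0)
  have hMr : (M : ℝ) ≠ 0 := by exact_mod_cast (by omega : M ≠ 0)
  have he' : (2 : ℂ) * (ε' : ℂ) = e := by exact_mod_cast congrArg (fun x : ℝ => (x : ℂ)) he
  -- The shift by e appears because -ε' = ε' - e.
  have ex : (z₁ - (ε' + J) + ε * τ) / M + r * (τ / M) + p =
      (z₁ + (ε' + ((M * p - e - J : ℤ) : ℂ)) + (ε + r) * τ) / M := by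
    push_cast
    rw [← he']
    field_simp
    ring
  have eV : (((z₁ - (ε' + J) + ε * τ) / M - (z₂ - (ε' + K) + ε * τ) / M) / 2).im =
      ((z₁ - z₂) / 2).im / M := by
    have : ((z₁ - (ε' + J) + ε * τ) / M - (z₂ - (ε' + K) + ε * τ) / M) / 2 =
        (((z₁ - z₂) / 2) + ((((K : ℝ) - J) / 2 : ℝ) : ℂ)) / ((M : ℝ) : ℂ) := by
      push_cast
      ring
    rw [this, div_ofReal_im, add_im, ofReal_im, add_zero]
  have eg : ∀ (V : ℝ) (x : ℂ), tiltedGaussian (gaussWidth m (τ / M)) (V / M) (x / M) =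
      tiltedGaussian (gaussWidth m (M * τ)) V x := by
    intro V x
    have h1 : (τ / (M : ℂ)).im = τ.im / M := by
      rw [show (M : ℂ) = ((M : ℝ) : ℂ) by simp, div_ofReal_im]
    have h2 : ((M : ℂ) * τ).im = M * τ.im := by
      rw [show (M : ℂ) = ((M : ℝ) : ℂ) by simp, im_ofReal_mul]
    have h3 : (τ.im : ℂ) ≠ 0 := by exact_mod_cast hτ.ne'
    rw [tiltedGaussian, tiltedGaussian, gaussWidth, gaussWidth, h1, h2]
    congr 1
    push_cast
    field_simp
  simp only [poincareTerm, levelTerm, levelKernel, thetaFactor]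
  rw [ex, eV, eg, div_div_eq_mul_div]
  have e3 : exp (Real.pi * I * (2 * m + 1) / M *
        (ε * (z₁ + z₂ - (ε' + J) - (ε' + K)) + ε ^ 2 * τ)) *
      exp (Real.pi * I * (2 * m + 1) * (r * ((z₁ - (ε' + J) + ε * τ) / M +
        (z₂ - (ε' + K) + ε * τ) / M) + r ^ 2 * (τ / M))) =
      exp (-(Real.pi * I * (2 * m + 1) / M * ((ε + r) * ((ε' + J) + (ε' + K))))) *
      exp (Real.pi * I * (2 * m + 1) / M * ((ε + r) * (z₁ + z₂) + (ε + r) ^ 2 * τ)) := by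
    rw [← exp_add, ← exp_add]
    congr 1
    field_simp
    ring
  linear_combination (-1 : ℂ) ^ r * (-1 : ℂ) ^ p *
    (tiltedGaussian (gaussWidth m (M * τ)) ((z₁ - z₂) / 2).im
      (z₁ + (ε' + ((M * p - e - J : ℤ) : ℂ)) + (ε + r) * τ) * M /
      (z₁ + (ε' + ((M * p - e - J : ℤ) : ℂ)) + (ε + r) * τ)) * e3

theorem poincareTerm_mul_level {M : ℕ} (hM : Odd M) (m : ℕ) {τ : ℂ} (hτ : 0 < τ.im) (z₁ z₂ : ℂ)
    (ε : ℝ) {ε' : ℝ} {e J K A B : ℤ} (he : 2 * ε' = e) (hJK : Even (J - K)) (r P : ℤ) :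
    (-1 : ℂ) ^ A * exp (-(Real.pi * I * (2 * m + 1) / M *
        ((ε + A) * (ε' + K) + (ε + B) * (ε' + J)))) *
      exp (Real.pi * I * (2 * m + 1) / M *
        ((ε + A) * (ε + B) * τ + (ε + B) * z₁ + (ε + A) * z₂)) *
      poincareTerm m (M * τ) (z₁ + (ε + A) * τ + ε') (z₂ + (ε + B) * τ + ε') (r, P) =
    (-1 : ℂ) ^ P * levelTerm M m ε ε' (ε' + J) (ε' + K) τ z₁ z₂ (A + r * M) P *
      exp (-(Real.pi * I * (2 * m + 1) / M * ((B - A) * (P + J + e)))) := by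
  have hM0 : (M : ℂ) ≠ 0 := by exact_mod_cast hM.pos.ne'
  have he' : (2 : ℂ) * (ε' : ℂ) = e := by exact_mod_cast congrArg (fun x : ℝ => (x : ℂ)) he
  have ex : z₁ + (ε + A) * τ + ε' + r * (M * τ) + P =
      z₁ + (ε' + P) + (ε + ((A + r * M : ℤ) : ℂ)) * τ := by
    push_cast
    ring
  have eV : ((z₁ + (ε + A) * τ + ε' - (z₂ + (ε + B) * τ + ε')) / 2).im =
      ((z₁ - z₂) / 2).im + (A - B) * τ.im / 2 := by
    have : (z₁ + (ε + A) * τ + ε' - (z₂ + (ε + B) * τ + ε')) / 2 =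
        (z₁ - z₂) / 2 + ((((A : ℝ) - B) / 2 : ℝ) : ℂ) * τ := by
      push_cast
      ring
    rw [this, add_im, im_ofReal_mul]
    ring
  -- Different real coefficients of τ in the two arguments change the tilt; the price is an
  -- exponential linear in x, the source of the character in P.
  have eg : ∀ (V : ℝ) (x : ℂ),
      tiltedGaussian (gaussWidth m (M * τ)) (V + (A - B) * τ.im / 2) x =
      tiltedGaussian (gaussWidth m (M * τ)) V x *
        exp (-(Real.pi * I * (2 * m + 1) / M * ((B - A) * x))) := by
    intro V x
    have h2 : ((M : ℂ) * τ).im = M * τ.im := by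
      rw [show (M : ℂ) = ((M : ℝ) : ℂ) by simp, im_ofReal_mul]
    have h3 : (τ.im : ℂ) ≠ 0 := by exact_mod_cast hτ.ne'
    rw [tiltedGaussian, tiltedGaussian, gaussWidth, h2, ← exp_add]
    congr 1
    push_cast
    field_simp
    ring
  simp only [poincareTerm, levelTerm, levelKernel, thetaFactor]
  rw [ex, eV, eg]
  have es : (-1 : ℂ) ^ A * (-1 : ℂ) ^ r = (-1 : ℂ) ^ (A + r * M) := by
    rw [← zpow_add₀ (by norm_num)]
    obtain ⟨c, rfl⟩ := hM
    refine neg_one_zpow_congr ⟨-(r * c), ?_⟩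
    push_cast
    ring
  rw [← es]
  set x := z₁ + (ε' + P) + (ε + ((A + r * M : ℤ) : ℂ)) * τ with hx
  have e3 : exp (-(Real.pi * I * (2 * m + 1) / M *
        ((ε + A) * (ε' + K) + (ε + B) * (ε' + J)))) *
      exp (Real.pi * I * (2 * m + 1) / M *
        ((ε + A) * (ε + B) * τ + (ε + B) * z₁ + (ε + A) * z₂)) *
      (exp (Real.pi * I * (2 * m + 1) * (r * (z₁ + (ε + A) * τ + ε' + (z₂ + (ε + B) * τ + ε')) +
        r ^ 2 * (M * τ))) * exp (-(Real.pi * I * (2 * m + 1) / M * ((B - A) * x)))) =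
      exp (-(Real.pi * I * (2 * m + 1) / M *
        ((ε + ((A + r * M : ℤ) : ℂ)) * ((ε' + J) + (ε' + K))))) *
      exp (Real.pi * I * (2 * m + 1) / M * ((ε + ((A + r * M : ℤ) : ℂ)) * (z₁ + z₂) +
        (ε + ((A + r * M : ℤ) : ℂ)) ^ 2 * τ)) *
      exp (-(Real.pi * I * (2 * m + 1) / M * ((B - A) * (P + J + e)))) := by
    -- The leftover phase is πi(2m+1)r(2e + J + K), a multiple of 2πi because J and K have the same
    -- parity.
    obtain ⟨c, hc⟩ := hJK
    have hJ : (J : ℂ) = K + c + c := by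
      have : J = K + c + c := by omega
      exact_mod_cast this
    rw [← exp_add, ← exp_add, ← exp_add, ← exp_add, ← exp_add]
    have : -(Real.pi * I * (2 * m + 1) / M * ((ε + A) * (ε' + K) + (ε + B) * (ε' + J))) +
        Real.pi * I * (2 * m + 1) / M *
          ((ε + A) * (ε + B) * τ + (ε + B) * z₁ + (ε + A) * z₂) +
        (Real.pi * I * (2 * m + 1) * (r * (z₁ + (ε + A) * τ + ε' + (z₂ + (ε + B) * τ + ε')) +
          r ^ 2 * (M * τ)) + -(Real.pi * I * (2 * m + 1) / M * ((B - A) * x))) =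
        -(Real.pi * I * (2 * m + 1) / M *
          ((ε + ((A + r * M : ℤ) : ℂ)) * ((ε' + J) + (ε' + K)))) +
        Real.pi * I * (2 * m + 1) / M * ((ε + ((A + r * M : ℤ) : ℂ)) * (z₁ + z₂) +
          (ε + ((A + r * M : ℤ) : ℂ)) ^ 2 * τ) +
        -(Real.pi * I * (2 * m + 1) / M * ((B - A) * (P + J + e))) +
        (((2 * m + 1) * r * (e + K + c) : ℤ) : ℂ) * (2 * Real.pi * I) := by
      rw [hx, hJ]
      push_cast
      rw [← he']
      field_simp
      ring
    rw [this, exp_add _ (_ * (2 * Real.pi * I)), exp_int_mul_two_pi_mul_I, mul_one]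
  linear_combination (-1 : ℂ) ^ A * (-1 : ℂ) ^ r * (-1 : ℂ) ^ P *
    (tiltedGaussian (gaussWidth m (M * τ)) ((z₁ - z₂) / 2).im x / x) * e3

theorem isUnit_two_zmod {M : ℕ} (hM : Odd M) : IsUnit (2 : ZMod M) := by
  have h : Nat.Coprime 2 M := (Nat.coprime_two_left).2 hM
  exact_mod_cast (ZMod.isUnit_iff_coprime 2 M).2 h

/-- As B - A is even, the denominator 2M of the phase reduces to M, and halving becomes
multiplication by 2⁻¹ in ℤ/M. -/
theorem exp_eq_stdAddChar {M : ℕ} [NeZero M] (hM : Odd M) (s : ℕ) {A B : ℤ} (h : Even (A - B))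
    (n : ℤ) : exp (-(Real.pi * I * s / M * (((B : ℂ) - A) * n))) =
      ZMod.stdAddChar ((-(s : ZMod M) * 2⁻¹ * (n : ZMod M)) * ((B : ZMod M) - (A : ZMod M))) := by
  obtain ⟨c, hc⟩ := h
  have h1 : (-(s : ZMod M) * 2⁻¹ * (n : ZMod M)) * ((B : ZMod M) - (A : ZMod M)) = ((s * n * c : ℤ) : ZMod M) := by
    have h2 : (B : ZMod M) - (A : ZMod M) = -2 * c := by
      have : B - A = -2 * c := by omega
      exact_mod_cast congrArg (Int.cast : ℤ → ZMod M) this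
    have h3 := ZMod.inv_mul_of_unit _ (isUnit_two_zmod hM)
    rw [h2]
    push_cast
    linear_combination (s * n * c : ZMod M) * h3
  have h4 : (A : ℂ) = B + c + c := by
    have : A = B + c + c := by omega
    exact_mod_cast this
  rw [h1, ZMod.stdAddChar_coe, h4]
  congr 1
  push_cast
  ring

/-- Orthogonality over a set of pairs that represents `(ℤ/M)²`. -/
theorem sum_characters_residue {ι : Type*} {M : ℕ} (hM : Odd M) {s : ℕ} (hs : Nat.Coprime s M)
    (S : Finset ι) (A B : ι → ℤ) (hAB : ∀ i ∈ S, Even (A i - B i))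
    (hS : Set.BijOn (fun i => ((A i : ZMod M), (B i : ZMod M))) S Set.univ) (b n : ℤ) :
    ∑ i ∈ S, (if (b : ZMod M) = A i then
      exp (-(Real.pi * I * s / M * (((B i : ℂ) - A i) * n))) else 0) =
      if (n : ZMod M) = 0 then (M : ℂ) else 0 := by
  have : NeZero M := ⟨hM.pos.ne'⟩
  set c : ZMod M := -(s : ZMod M) * 2⁻¹ * n with hc
  have h1 : ∑ i ∈ S, (if (b : ZMod M) = A i then
      exp (-(Real.pi * I * s / M * (((B i : ℂ) - A i) * n))) else 0) =
      ∑ x : ZMod M × ZMod M, if (b : ZMod M) = x.1 then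
        (ZMod.stdAddChar (c * (x.2 - x.1)) : ℂ) else 0 := by
    refine Finset.sum_nbij (fun i => ((A i : ZMod M), (B i : ZMod M))) (fun _ _ => Finset.mem_univ _)
      hS.injOn (by simpa using hS.surjOn) fun i hi => ?_
    simp only [exp_eq_stdAddChar hM s (hAB i hi), hc]
  -- Coprimality enters here: both s and 2 are invertible modulo M, so the character is trivial only
  -- for n ≡ 0.
  have h2 : c = 0 ↔ (n : ZMod M) = 0 := by
    have u1 : IsUnit (s : ZMod M) := (ZMod.isUnit_iff_coprime s M).2 hs
    have u2 := isUnit_two_zmod hM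
    have u3 : IsUnit (-(s : ZMod M) * 2⁻¹) :=
      u1.neg.mul (IsUnit.of_mul_eq_one _ (ZMod.inv_mul_of_unit _ u2))
    rw [hc]
    exact u3.mul_right_eq_zero
  rw [h1, Fintype.sum_prod_type]
  simp only [Finset.sum_ite_irrel, Finset.sum_const_zero, Finset.sum_ite_eq, Finset.mem_univ,
    if_true]
  rw [← Equiv.sum_comp (Equiv.addRight (b : ZMod M))]
  simp only [Equiv.coe_addRight, add_sub_cancel_right]
  have h3 := AddChar.sum_mulShift (R := ZMod M) (R' := ℂ) (ψ := ZMod.stdAddChar) c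
    (ZMod.isPrimitive_stdAddChar M)
  simp only [mul_comm c]
  rw [h3, ZMod.card]
  simp only [h2]
  split_ifs <;> simp

/-- The lattice sum at `τ / M` as a combination of lattice sums at `Mτ`. -/
theorem poincare_level {ι : Type*} {M : ℕ} (hM : Odd M) (m : ℕ) (hs : Nat.Coprime (2 * m + 1) M)
    (S : Finset ι) (A B : ι → ℤ) (hAB : ∀ i ∈ S, Even (A i - B i))
    (hS : Set.BijOn (fun i => ((A i : ZMod M), (B i : ZMod M))) S Set.univ)
    {τ : ℂ} (hτ : 0 < τ.im) (z₁ z₂ : ℂ) (ε : ℝ) {ε' : ℝ} {e J K : ℤ} (he : 2 * ε' = e)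
    (hJK : Even (J - K)) :
    exp (Real.pi * I * (2 * m + 1) / M *
        (ε * (z₁ + z₂ - (ε' + J) - (ε' + K)) + ε ^ 2 * τ)) *
      poincare m (τ / M) ((z₁ - (ε' + J) + ε * τ) / M) ((z₂ - (ε' + K) + ε * τ) / M) =
    (-1 : ℂ) ^ (e + J) * ∑ i ∈ S, (-1 : ℂ) ^ A i * exp (-(Real.pi * I * (2 * m + 1) / M *
        ((ε + A i) * (ε' + K) + (ε + B i) * (ε' + J)))) *
      exp (Real.pi * I * (2 * m + 1) / M *
        ((ε + A i) * (ε + B i) * τ + (ε + B i) * z₁ + (ε + A i) * z₂)) *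
      poincare m (M * τ) (z₁ + (ε + A i) * τ + ε') (z₂ + (ε + B i) * τ + ε') := by
  have hM1 : 1 ≤ M := hM.pos
  have hMr : (0 : ℝ) < M := by exact_mod_cast hM1
  have hMz : (M : ℤ) ≠ 0 := by exact_mod_cast hMr.ne'
  have hτ1 : 0 < (τ / (M : ℂ)).im := by
    rw [show (M : ℂ) = ((M : ℝ) : ℂ) by simp, div_ofReal_im]
    positivity
  have hτ2 : 0 < ((M : ℂ) * τ).im := by
    rw [show (M : ℂ) = ((M : ℝ) : ℂ) by simp, im_ofReal_mul]
    positivity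
  let F : ℤ × ℤ → ℂ := fun n => levelTerm M m ε ε' (ε' + J) (ε' + K) τ z₁ z₂ n.1 n.2
  -- The sum at Mτ attached to i runs over the rows b ≡ A i modulo M, with P free.
  have hR : ∀ i ∈ S, HasSum (fun n : ℤ × ℤ => if (n.1 : ZMod M) = A i then (-1 : ℂ) ^ n.2 * F n *
      exp (-(Real.pi * I * ((2 * m + 1 : ℕ) : ℂ) / M *
        (((B i : ℂ) - A i) * ((n.2 + J + e : ℤ) : ℂ)))) else 0)
      ((-1 : ℂ) ^ A i * exp (-(Real.pi * I * (2 * m + 1) / M *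
        ((ε + A i) * (ε' + K) + (ε + B i) * (ε' + J)))) *
      exp (Real.pi * I * (2 * m + 1) / M *
        ((ε + A i) * (ε + B i) * τ + (ε + B i) * z₁ + (ε + A i) * z₂)) *
      poincare m (M * τ) (z₁ + (ε + A i) * τ + ε') (z₂ + (ε + B i) * τ + ε')) := by
    intro i hi
    have hinj : Function.Injective (fun q : ℤ × ℤ => ((A i + q.1 * M, q.2) : ℤ × ℤ)) := by
      rintro ⟨r, P⟩ ⟨r', P'⟩ hq
      simpa [hM.pos.ne'] using hq
    refine (hinj.hasSum_iff ?_).1 (((summable_poincareTerm m hτ2 _ _).hasSum.mul_left _).congr_fun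
      fun q => ?_)
    · rintro ⟨b, P⟩ hx
      refine if_neg fun hb => hx ?_
      obtain ⟨r, hr⟩ := (ZMod.intCast_eq_intCast_iff_dvd_sub (A i) b M).1 hb.symm
      exact ⟨(r, P), by
        simp only [Prod.mk.injEq, and_true]
        linear_combination -hr⟩
    · rw [poincareTerm_mul_level hM m hτ z₁ z₂ ε he hJK]
      simp only [Function.comp, F]
      rw [if_pos (by simp)]
      push_cast
      rfl
  -- The sum at τ/M runs over all rows b, with P ≡ -(J + e) modulo M.
  have hL : HasSum (fun n : ℤ × ℤ => if ((n.2 + J + e : ℤ) : ZMod M) = 0 then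
      (-1 : ℂ) ^ (e + J) * ((-1 : ℂ) ^ n.2 * F n * M) else 0)
      (exp (Real.pi * I * (2 * m + 1) / M *
        (ε * (z₁ + z₂ - (ε' + J) - (ε' + K)) + ε ^ 2 * τ)) *
      poincare m (τ / M) ((z₁ - (ε' + J) + ε * τ) / M) ((z₂ - (ε' + K) + ε * τ) / M)) := by
    have hinj : Function.Injective (fun q : ℤ × ℤ => ((q.1, M * q.2 - e - J) : ℤ × ℤ)) := by
      rintro ⟨r, P⟩ ⟨r', P'⟩ hq
      simpa [hM.pos.ne'] using hq
    refine (hinj.hasSum_iff ?_).1 (((summable_poincareTerm m hτ1 _ _).hasSum.mul_left _).congr_fun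
      fun q => ?_)
    · rintro ⟨b, P⟩ hx
      refine if_neg fun hb => hx ?_
      obtain ⟨p, hp⟩ := (ZMod.intCast_zmod_eq_zero_iff_dvd _ M).1 hb
      exact ⟨(b, p), by
        simp only [Prod.mk.injEq, true_and]
        linear_combination -hp⟩
    · rw [poincareTerm_div_level hM1 m hτ z₁ z₂ ε he]
      simp only [Function.comp, F]
      rw [if_pos (by simp)]
      have hsgn : (-1 : ℂ) ^ q.2 = (-1 : ℂ) ^ (e + J) * (-1 : ℂ) ^ (M * q.2 - e - J) := by
        rw [← zpow_add₀ (by norm_num)]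
        obtain ⟨c, rfl⟩ := hM
        refine neg_one_zpow_congr ⟨-(c * q.2), ?_⟩
        push_cast
        ring
      rw [hsgn]
      ring
  have hsum := (hasSum_sum hR).mul_left ((-1 : ℂ) ^ (e + J))
  refine hL.unique (hsum.congr_fun fun n => ?_)
  have hc := sum_characters_residue hM hs S A B hAB hS n.1 (n.2 + J + e)
  have : ∑ i ∈ S, (if (n.1 : ZMod M) = A i then (-1 : ℂ) ^ n.2 * F n *
      exp (-(Real.pi * I * ((2 * m + 1 : ℕ) : ℂ) / M *
        (((B i : ℂ) - A i) * ((n.2 + J + e : ℤ) : ℂ)))) else 0) =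
      (-1 : ℂ) ^ n.2 * F n * if ((n.2 + J + e : ℤ) : ZMod M) = 0 then (M : ℂ) else 0 := by
    rw [← hc, Finset.mul_sum]
    exact Finset.sum_congr rfl fun i _ => by rw [mul_ite, mul_zero]
  rw [this]
  split_ifs <;> simp

/-! ### The index set Ω as a set of representatives of (ℤ/M)². -/

/-- Integer pairs `(A, B)` such that `(ε + A, ε + B)` runs over `Ω^{[B;M;ε]}`. -/
def omegaPairs (M : ℕ) : Finset (ℤ × ℤ) :=
  (Finset.Ico (-(M : ℤ)) M ×ˢ Finset.Ico (0 : ℤ) M).filter fun q => Even (q.1 - q.2)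

theorem mem_omegaPairs {M : ℕ} {q : ℤ × ℤ} : q ∈ omegaPairs M ↔
    ((-(M : ℤ) ≤ q.1 ∧ q.1 < M) ∧ 0 ≤ q.2 ∧ q.2 < M) ∧ Even (q.1 - q.2) := by
  simp [omegaPairs]

/-- Each residue has two representatives in [-M, M), differing by the odd number M and so of
opposite parity; the parity condition selects one. -/
theorem omegaPairs_bijOn {M : ℕ} (hM : Odd M) :
    Set.BijOn (fun q : ℤ × ℤ => ((q.1 : ZMod M), (q.2 : ZMod M))) (omegaPairs M) Set.univ := by
  have hM0 : (0 : ℤ) < M := by exact_mod_cast hM.pos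
  refine ⟨fun _ _ => Set.mem_univ _, ?_, ?_⟩
  · rintro ⟨A, B⟩ hq ⟨A', B'⟩ hq' heq
    obtain ⟨⟨⟨h1, h2⟩, h3, h4⟩, c, hc⟩ := mem_omegaPairs.1 hq
    obtain ⟨⟨⟨h1', h2'⟩, h3', h4'⟩, c', hc'⟩ := mem_omegaPairs.1 hq'
    simp only [Prod.mk.injEq] at heq h1 h2 h3 h4 hc h1' h2' h3' h4' hc'
    obtain ⟨k, hk⟩ := (ZMod.intCast_eq_intCast_iff_dvd_sub _ _ _).1 heq.2
    have hk0 : k = 0 := by nlinarith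
    have hB : B = B' := by
      rw [hk0] at hk
      linarith
    obtain ⟨l, hl⟩ := (ZMod.intCast_eq_intCast_iff_dvd_sub _ _ _).1 heq.1
    have hl2 : l < 2 := by nlinarith
    have hl3 : -2 < l := by nlinarith
    have hle : Even (M * l) := ⟨c' - c, by rw [← hl]; linarith⟩
    have hl4 : Even l := by
      rcases Int.even_mul.1 hle with h | h
      · exact absurd ((Int.even_coe_nat M).1 h) (Nat.not_even_iff_odd.2 hM)
      · exact h
    have hl0 : l = 0 := by
      obtain ⟨d, rfl⟩ := hl4
      omega
    rw [hl0] at hl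
    rw [hB, show A = A' by linarith]
  · rintro ⟨x, y⟩ -
    obtain ⟨X, rfl⟩ := ZMod.intCast_surjective x
    obtain ⟨Y, rfl⟩ := ZMod.intCast_surjective y
    have hx0 := Int.emod_nonneg X hM0.ne'
    have hx1 := Int.emod_lt_of_pos X hM0
    have hy0 := Int.emod_nonneg Y hM0.ne'
    have hy1 := Int.emod_lt_of_pos Y hM0
    obtain ⟨u, hu⟩ := hM
    by_cases hpar : Even (X % M - Y % M)
    · exact ⟨(X % M, Y % M), mem_omegaPairs.2 ⟨⟨⟨by linarith, hx1⟩, hy0, hy1⟩, hpar⟩, by simp⟩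
    · refine ⟨(X % M - M, Y % M), mem_omegaPairs.2 ⟨⟨⟨by linarith, by linarith⟩, hy0, hy1⟩, ?_⟩,
        by simp⟩
      obtain ⟨v, hv⟩ := Int.not_even_iff_odd.1 hpar
      refine ⟨v - u, ?_⟩
      have : (M : ℤ) = 2 * u + 1 := by exact_mod_cast hu
      simp only
      linarith

/-- Because 0 ≤ ε < 1 and M is an integer, the bounds on ε + A and ε + B are equivalent to the same
bounds on A and B. -/
theorem mem_Omega_iff {M : ℕ} {ε : ℝ} (hε : ε = 0 ∨ ε = 1 / 2) {p : ℝ × ℝ} :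
    p ∈ Omega M ε ↔ ∃ q ∈ omegaPairs M, ((ε + q.1 : ℝ), (ε + q.2 : ℝ)) = p := by
  have hε0 : 0 ≤ ε := by rcases hε with h | h <;> simp [h]
  have hε1 : ε < 1 := by rcases hε with h | h <;> rw [h] <;> norm_num
  constructor
  · rintro ⟨⟨A, hA⟩, ⟨B, hB⟩, h1, h2, h3, h4, l, hl⟩
    refine ⟨(A, B), mem_omegaPairs.2 ⟨⟨⟨?_, ?_⟩, ?_, ?_⟩, l, ?_⟩, by rw [← hA, ← hB]⟩
    · have : (-(M : ℤ) : ℝ) < A + 1 := by push_cast; linarith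
      have : -(M : ℤ) < A + 1 := by exact_mod_cast this
      exact Int.lt_add_one_iff.1 this
    · have : (A : ℝ) < (M : ℤ) := by push_cast; linarith
      exact_mod_cast this
    · have : ((0 : ℤ) : ℝ) < B + 1 := by push_cast; linarith
      have : 0 < B + 1 := by exact_mod_cast this
      exact Int.lt_add_one_iff.1 this
    · have : (B : ℝ) < (M : ℤ) := by push_cast; linarith
      exact_mod_cast this
    · have : (A : ℝ) - B = l + l := by linarith
      exact_mod_cast this
  · rintro ⟨⟨A, B⟩, hq, rfl⟩
    obtain ⟨⟨⟨h1, h2⟩, h3, h4⟩, c, hc⟩ := mem_omegaPairs.1 hq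
    simp only at h1 h2 h3 h4 hc
    have g1 : -(M : ℝ) ≤ A := by exact_mod_cast h1
    have g2 : (A : ℝ) + 1 ≤ M := by exact_mod_cast h2
    have g3 : (0 : ℝ) ≤ B := by exact_mod_cast h3
    have g4 : (B : ℝ) + 1 ≤ M := by exact_mod_cast h4
    refine ⟨⟨A, rfl⟩, ⟨B, rfl⟩, ?_, ?_, ?_, ?_, c, ?_⟩
    · simp only; linarith
    · simp only; linarith
    · simp only; linarith
    · simp only; linarith
    · have : (A : ℝ) - B = c + c := by exact_mod_cast hc
      simp only
      linarith

theorem sum_Omega {M : ℕ} {ε : ℝ} (hε : ε = 0 ∨ ε = 1 / 2) (f : ℝ × ℝ → ℂ) :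
    ∑ p ∈ (Omega_finite M ε).toFinset, f p =
      ∑ q ∈ omegaPairs M, f ((ε + q.1 : ℝ), (ε + q.2 : ℝ)) := by
  have h : (Omega_finite M ε).toFinset =
      (omegaPairs M).image fun q => ((ε + q.1 : ℝ), (ε + q.2 : ℝ)) := by
    ext p
    rw [Set.Finite.mem_toFinset, mem_Omega_iff hε, Finset.mem_image]
  rw [h, Finset.sum_image]
  rintro ⟨A, B⟩ _ ⟨A', B'⟩ _ heq
  simpa using heq

/-! ### The transformation laws of Ψ̃. -/

theorem signPow_intCast (n : ℤ) : signPow n = (-1 : ℂ) ^ n := by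
  rw [signPow, neg_one_zpow_eq_exp, ofReal_intCast]

theorem im_natCast_mul_pos {M : ℕ} (hM : 1 ≤ M) {τ : ℂ} (hτ : 0 < τ.im) :
    0 < ((M : ℂ) * τ).im := by
  have hMr : (0 : ℝ) < M := by exact_mod_cast hM
  rw [show (M : ℂ) = ((M : ℝ) : ℂ) by simp, im_ofReal_mul]
  positivity

theorem im_div_natCast_pos {M : ℕ} (hM : 1 ≤ M) {τ : ℂ} (hτ : 0 < τ.im) :
    0 < (τ / (M : ℂ)).im := by
  have hMr : (0 : ℝ) < M := by exact_mod_cast hM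
  rw [show (M : ℂ) = ((M : ℝ) : ℂ) by simp, div_ofReal_im]
  positivity

theorem im_neg_inv_pos {τ : ℂ} (hτ : 0 < τ.im) : 0 < (-1 / τ).im := by
  have h0 : τ ≠ 0 := by
    rintro rfl
    simp at hτ
  rw [neg_div, one_div, neg_im, inv_im, neg_div, neg_neg]
  exact div_pos hτ (normSq_pos.2 h0)

theorem PhiRegular.lattice_ne_zero {τ z₁ z₂ : ℂ} (h : PhiRegular τ z₁ z₂) :
    (∀ r p : ℤ, z₁ + r * τ + p ≠ 0) ∧ ∀ r p : ℤ, z₂ + r * τ + p ≠ 0 := by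
  refine ⟨fun r p h0 => (h (-p) (-r)).1 ?_, fun r p h0 => (h (-p) (-r)).2 ?_⟩ <;>
  · push_cast
    linear_combination h0

theorem exists_two_mul_eq {ε : ℝ} (hε : ε = 0 ∨ ε = 1 / 2) : ∃ e : ℤ, 2 * ε = e := by
  rcases hε with rfl | rfl
  · exact ⟨0, by simp⟩
  · exact ⟨1, by simp⟩

/-- `Φ̃` under `τ ↦ -1/τ`. -/
theorem PhiTilde_neg_inv (m : ℕ) {τ : ℂ} (hτ : 0 < τ.im) {z₁ z₂ : ℂ} (t : ℂ)
    (hz₁ : ∀ r p : ℤ, z₁ + r * τ + p ≠ 0) (hz₂ : ∀ r p : ℤ, z₂ + r * τ + p ≠ 0) :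
    PhiTilde m (-1 / τ) (z₁ / τ) (z₂ / τ) t =
      τ * (I / (2 * Real.pi) * exp (Real.pi * I * (2 * m + 1) * (t + z₁ * z₂ / τ)) *
        (poincare m τ z₁ z₂ - poincare m τ z₂ z₁)) := by
  have h0 : τ ≠ 0 := by
    rintro rfl
    simp at hτ
  have hreg : ∀ z : ℂ, (∀ r p : ℤ, z + r * τ + p ≠ 0) →
      ∀ r p : ℤ, z / τ + r * (-1 / τ) + p ≠ 0 := by
    intro z hz r p h
    refine hz p (-r) ?_
    have : z + p * τ + ((-r : ℤ) : ℂ) = τ * (z / τ + r * (-1 / τ) + p) := by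
      push_cast
      field_simp
      ring
    rw [this, h, mul_zero]
  have h1 := poincare_neg_inv m hτ z₁ z₂
  have h2 := poincare_neg_inv m hτ z₂ z₁
  rw [mul_comm z₂ z₁] at h2
  have hexp : exp (Real.pi * I * (2 * m + 1) * t) =
      exp (Real.pi * I * (2 * m + 1) * (t + z₁ * z₂ / τ)) *
        exp (-(Real.pi * I * (2 * m + 1) * (z₁ * z₂ / τ))) := by
    rw [← exp_add]
    congr 1
    ring
  rw [PhiTilde_eq_poincare m (im_neg_inv_pos hτ) t (hreg z₁ hz₁) (hreg z₂ hz₂), hexp]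
  linear_combination I / (2 * Real.pi) * exp (Real.pi * I * (2 * m + 1) * (t + z₁ * z₂ / τ)) *
    (h1 - h2)

theorem PsiTilde_add_one {M m : ℕ} (hM : Odd M) {ε ε' j k : ℝ}
    (hε : ε = 0 ∨ ε = 1 / 2) (hε' : ε' = 0 ∨ ε' = 1 / 2) (hjk : (j, k) ∈ Omega M ε')
    {τ z₁ z₂ : ℂ} (t : ℂ) (hτ : 0 < τ.im) (hreg : PsiRegular M ε j k (τ + 1) z₁ z₂) :
    PsiTilde M m ε j k ε' (τ + 1) z₁ z₂ t =
      signPow (j - ε' + 4 * ε * ε') *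
        exp (2 * Real.pi * I * (2 * m + 1) / (2 * M) * (j * k)) *
        PsiTilde M m |ε - ε'| j k ε' τ z₁ z₂ t := by
  obtain ⟨q, hq, hqe⟩ := (mem_Omega_iff hε').1 hjk
  obtain ⟨J, K⟩ := q
  simp only [Prod.mk.injEq] at hqe
  obtain ⟨rfl, rfl⟩ := hqe
  have hJK : Even (J - K) := (mem_omegaPairs.1 hq).2
  -- The translation of τ moves the shift ε to ε + ε', which differs from |ε - ε'| by the integer d
  -- = 4εε'; d = 1 only when both are 1/2.
  obtain ⟨d, hd, hd'⟩ : ∃ d : ℤ, 4 * ε * ε' = d ∧ ε + ε' = |ε - ε'| + d := by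
    rcases hε with rfl | rfl <;> rcases hε' with rfl | rfl
    · exact ⟨0, by norm_num⟩
    · exact ⟨0, by norm_num [abs_of_pos]⟩
    · exact ⟨0, by norm_num [abs_of_pos]⟩
    · exact ⟨1, by norm_num⟩
  have hdC : (ε : ℂ) + ε' = (|ε - ε'| : ℝ) + d := by exact_mod_cast congrArg ofReal hd'
  have hM1 : 1 ≤ M := hM.pos
  have hM0 : (M : ℂ) ≠ 0 := by exact_mod_cast hM.pos.ne'
  set δ := |ε - ε'|
  have e1 : ∀ (z : ℂ) (N : ℤ), z + ((ε' + N : ℝ) : ℂ) * (τ + 1) + ε =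
      z + ((ε' + N : ℝ) : ℂ) * τ + δ + ((N + d : ℤ) : ℂ) := by
    intro z N
    push_cast
    linear_combination hdC
  have eτ : (M : ℂ) * (τ + 1) = M * τ + ((M : ℤ) : ℂ) := by
    push_cast
    ring
  have hpar : Even ((J + d) - (K + d)) := by simpa using hJK
  have hpar' : Even ((K + d) - (J + d)) := by simpa using hJK.neg
  obtain ⟨hr1, hr2⟩ := PhiRegular.lattice_ne_zero hreg
  have hτM := im_natCast_mul_pos hM1 hτ
  have hτM' : 0 < ((M : ℂ) * (τ + 1)).im := im_natCast_mul_pos hM1 (by simpa using hτ)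
  have htrans : ∀ (z : ℂ) (N : ℤ),
      (∀ r p : ℤ, z + ((ε' + N : ℝ) : ℂ) * (τ + 1) + ε + r * (M * (τ + 1)) + p ≠ 0) →
      ∀ r p : ℤ, z + ((ε' + N : ℝ) : ℂ) * τ + δ + r * (M * τ) + p ≠ 0 := by
    intro z N hz r p h
    refine hz r (p - r * M - (N + d)) ?_
    rw [e1]
    push_cast at h ⊢
    linear_combination h
  have hsgn : (-1 : ℂ) ^ (K + d) = (-1 : ℂ) ^ (J + d) := neg_one_zpow_congr hpar'
  have hsP : signPow (ε' + J - ε' + 4 * ε * ε') = (-1 : ℂ) ^ (J + d) := by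
    rw [hd, ← signPow_intCast]
    congr 1
    push_cast
    ring
  have hq1 : qpow (τ + 1) ((2 * m + 1) / (2 * M) * ((ε' + J : ℝ) : ℂ) * ((ε' + K : ℝ) : ℂ)) =
      exp (2 * Real.pi * I * (2 * m + 1) / (2 * M) *
        (((ε' + J : ℝ) : ℂ) * ((ε' + K : ℝ) : ℂ))) *
      qpow τ ((2 * m + 1) / (2 * M) * ((ε' + J : ℝ) : ℂ) * ((ε' + K : ℝ) : ℂ)) := by
    rw [qpow, qpow, ← exp_add]
    congr 1
    ring
  rw [PsiTilde, PsiTilde, PhiTilde_eq_poincare m hτM' _ hr1 hr2,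
    PhiTilde_eq_poincare m hτM _ (htrans z₁ J hr1) (htrans z₂ K hr2), hq1, hsP, e1, e1, eτ,
    poincare_add_int, poincare_add_int, poincare_shift m _ _ _ hpar, poincare_shift m _ _ _ hpar',
    hsgn]
  ring

theorem PsiTilde_neg_inv {M m : ℕ} (hM : Odd M) (hs : Nat.Coprime (2 * m + 1) M) {ε ε' j k : ℝ}
    (hε : ε = 0 ∨ ε = 1 / 2) (hε' : ε' = 0 ∨ ε' = 1 / 2) (hjk : (j, k) ∈ Omega M ε')
    {τ z₁ z₂ : ℂ} (t : ℂ) (hτ : 0 < τ.im)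
    (hreg : ∀ p ∈ Omega M ε, PsiRegular M ε' p.1 p.2 τ z₁ z₂) :
    PsiTilde M m ε j k ε' (-1 / τ) (z₁ / τ) (z₂ / τ) (t - z₁ * z₂ / τ) =
      τ / M * signPow (ε' + j) *
        ∑ p ∈ (Omega_finite M ε).toFinset,
          signPow (p.1 - ε) *
            exp (-(2 * Real.pi * I * (2 * m + 1) / (2 * M)) * (p.1 * k + p.2 * j)) *
            PsiTilde M m ε' p.1 p.2 ε τ z₁ z₂ t := by
  obtain ⟨q, hq, hqe⟩ := (mem_Omega_iff hε').1 hjk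
  obtain ⟨J, K⟩ := q
  simp only [Prod.mk.injEq] at hqe
  obtain ⟨rfl, rfl⟩ := hqe
  have hJK : Even (J - K) := (mem_omegaPairs.1 hq).2
  have hKJ : Even (K - J) := by simpa using hJK.neg
  obtain ⟨e, he⟩ := exists_two_mul_eq hε'
  have heC : (2 : ℂ) * ε' = e := by exact_mod_cast congrArg ofReal he
  have hM1 : 1 ≤ M := hM.pos
  have hM0 : (M : ℂ) ≠ 0 := by exact_mod_cast hM.pos.ne'
  have h0 : τ ≠ 0 := by
    rintro rfl
    simp at hτ
  have hτM := im_natCast_mul_pos hM1 hτ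
  have hτM' := im_div_natCast_pos hM1 hτ
  have hterm : ∀ q ∈ omegaPairs M,
      (∀ r p : ℤ, z₁ + (ε + q.1) * τ + ε' + r * (M * τ) + p ≠ 0) ∧
      ∀ r p : ℤ, z₂ + (ε + q.2) * τ + ε' + r * (M * τ) + p ≠ 0 := by
    intro q hq
    have h := PhiRegular.lattice_ne_zero (hreg (ε + q.1, ε + q.2) ((mem_Omega_iff hε).2 ⟨q, hq, rfl⟩))
    simpa only [ofReal_add, ofReal_intCast] using h
  have hsurj := (omegaPairs_bijOn hM).surjOn
  -- Every b is congruent modulo M to a first coordinate occurring in Ω, so regularity of the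
  -- finitely many right-hand terms excludes all poles of the left side.
  have hreg1 : ∀ b P : ℤ, z₁ + (ε' + P) + (ε + b) * τ ≠ 0 := by
    intro b P h
    obtain ⟨q, hq, hqb⟩ := hsurj (Set.mem_univ ((b : ZMod M), (b : ZMod M)))
    obtain ⟨r, hr⟩ := (ZMod.intCast_eq_intCast_iff_dvd_sub q.1 b M).1 (congrArg Prod.fst hqb)
    refine (hterm q hq).1 r P ?_
    have hr' : (b : ℂ) - q.1 = M * r := by exact_mod_cast hr
    linear_combination h - τ * hr'
  have hreg2 : ∀ b P : ℤ, z₂ + (ε' + P) + (ε + b) * τ ≠ 0 := by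
    intro b P h
    obtain ⟨q, hq, hqb⟩ := hsurj (Set.mem_univ ((b : ZMod M), (b : ZMod M)))
    obtain ⟨r, hr⟩ := (ZMod.intCast_eq_intCast_iff_dvd_sub q.2 b M).1 (congrArg Prod.snd hqb)
    refine (hterm q hq).2 r P ?_
    have hr' : (b : ℂ) - q.2 = M * r := by exact_mod_cast hr
    linear_combination h - τ * hr'
  have htrans : ∀ (z : ℂ) (N : ℤ), (∀ b P : ℤ, z + (ε' + P) + (ε + b) * τ ≠ 0) →
      ∀ r p : ℤ, (z - (ε' + N) + ε * τ) / M + r * (τ / M) + p ≠ 0 := by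
    intro z N hz r p h
    refine hz r (M * p - e - N) ?_
    have : z + (ε' + ((M * p - e - N : ℤ) : ℂ)) + (ε + r) * τ =
        M * ((z - (ε' + N) + ε * τ) / M + r * (τ / M) + p) := by
      push_cast
      rw [← heC]
      field_simp
      ring
    rw [this, h, mul_zero]
  set Z₁ := (z₁ - (ε' + J) + ε * τ) / M with hZ₁
  set Z₂ := (z₂ - (ε' + K) + ε * τ) / M with hZ₂
  have eZ : ∀ (z : ℂ) (N : ℤ), z / τ + ((ε' + N : ℝ) : ℂ) * (-1 / τ) + ε =
      ((z - (ε' + N) + ε * τ) / M) / (τ / M) := by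
    intro z N
    push_cast
    field_simp
    ring
  have eτ : (M : ℂ) * (-1 / τ) = -1 / (τ / M) := by
    field_simp
  have hLHS : PsiTilde M m ε (ε' + J) (ε' + K) ε' (-1 / τ) (z₁ / τ) (z₂ / τ) (t - z₁ * z₂ / τ) =
      τ / M * (I / (2 * Real.pi)) * exp (Real.pi * I * (2 * m + 1) * (t / M)) *
      (exp (Real.pi * I * (2 * m + 1) / M *
        (ε * (z₁ + z₂ - (ε' + J) - (ε' + K)) + ε ^ 2 * τ)) *
          (poincare m (τ / M) Z₁ Z₂ - poincare m (τ / M) Z₂ Z₁)) := by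
    have hexp : qpow (-1 / τ) ((2 * m + 1) / (2 * M) * ((ε' + J : ℝ) : ℂ) * ((ε' + K : ℝ) : ℂ)) *
        exp (2 * Real.pi * I * (2 * m + 1) / (2 * M) *
          (((ε' + K : ℝ) : ℂ) * (z₁ / τ) + ((ε' + J : ℝ) : ℂ) * (z₂ / τ))) *
        exp (Real.pi * I * (2 * m + 1) * ((t - z₁ * z₂ / τ) / M + Z₁ * Z₂ / (τ / M))) =
        exp (Real.pi * I * (2 * m + 1) * (t / M)) *
          exp (Real.pi * I * (2 * m + 1) / M *
            (ε * (z₁ + z₂ - (ε' + J) - (ε' + K)) + ε ^ 2 * τ)) := by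
      rw [qpow, ← exp_add, ← exp_add, ← exp_add, hZ₁, hZ₂]
      congr 1
      push_cast
      field_simp
      ring
    rw [PsiTilde, eZ, eZ, eτ, PhiTilde_neg_inv m hτM' _ (htrans z₁ J hreg1) (htrans z₂ K hreg2)]
    linear_combination τ / M * (I / (2 * Real.pi)) *
      (poincare m (τ / M) Z₁ Z₂ - poincare m (τ / M) Z₂ Z₁) * hexp
  have hl1 := poincare_level hM m hs (omegaPairs M) Prod.fst Prod.snd
    (fun q hq => (mem_omegaPairs.1 hq).2) (omegaPairs_bijOn hM) hτ z₁ z₂ ε he hJK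
  -- The antisymmetric partner uses the same level formula with z₁ and z₂, J and K, and the
  -- coordinates of Ω exchanged.
  have hswap : Set.BijOn (fun q : ℤ × ℤ => ((q.2 : ZMod M), (q.1 : ZMod M))) (omegaPairs M)
      Set.univ :=
    (Set.bijOn_univ.2 (Equiv.prodComm (ZMod M) (ZMod M)).bijective).comp (omegaPairs_bijOn hM)
  have hl2 := poincare_level hM m hs (omegaPairs M) Prod.snd Prod.fst
    (fun q hq => by simpa using (mem_omegaPairs.1 hq).2.neg) hswap hτ z₂ z₁ ε he hKJ
  rw [hLHS, mul_sub, hl1]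
  rw [show z₁ + z₂ - (ε' + J) - (ε' + K) = z₂ + z₁ - (ε' + K) - (ε' + J) by ring, hl2,
    sum_Omega hε, neg_one_zpow_congr (a := e + K) (b := e + J) (by simpa using hKJ), ← mul_sub,
    ← Finset.sum_sub_distrib]
  have hsP : signPow (ε' + (ε' + J)) = (-1 : ℂ) ^ (e + J) := by
    rw [← signPow_intCast]
    congr 1
    push_cast
    linarith
  rw [hsP, mul_assoc (τ / M), mul_assoc (τ / M), mul_assoc (τ / M)]
  congr 1
  rw [mul_left_comm]
  congr 1
  rw [Finset.mul_sum]
  refine Finset.sum_congr rfl fun q hq => ?_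
  have hsq : signPow (ε + q.1 - ε) = (-1 : ℂ) ^ q.1 := by
    rw [add_sub_cancel_left, signPow_intCast]
  have hsq2 : (-1 : ℂ) ^ q.2 = (-1 : ℂ) ^ q.1 :=
    neg_one_zpow_congr (by simpa using (mem_omegaPairs.1 hq).2.neg)
  have hexp1 : qpow τ ((2 * m + 1) / (2 * M) * (ε + q.1) * (ε + q.2)) *
      exp (2 * Real.pi * I * (2 * m + 1) / (2 * M) * ((ε + q.2) * z₁ + (ε + q.1) * z₂)) =
      exp (Real.pi * I * (2 * m + 1) / M *
        ((ε + q.1) * (ε + q.2) * τ + (ε + q.2) * z₁ + (ε + q.1) * z₂)) := by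
    rw [qpow, ← exp_add]
    congr 1
    field_simp
    ring
  have hexp2 : exp (-(2 * Real.pi * I * (2 * m + 1) / (2 * M)) *
      ((ε + q.1) * (ε' + K) + (ε + q.2) * (ε' + J))) =
      exp (-(Real.pi * I * (2 * m + 1) / M *
        ((ε + q.1) * (ε' + K) + (ε + q.2) * (ε' + J)))) := by
    congr 1
    field_simp
  have hexp3 : exp (-(Real.pi * I * (2 * m + 1) / M *
        ((ε + q.2) * (ε' + J) + (ε + q.1) * (ε' + K)))) =
      exp (-(Real.pi * I * (2 * m + 1) / M *
        ((ε + q.1) * (ε' + K) + (ε + q.2) * (ε' + J)))) := by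
    congr 1
    ring
  have hexp4 : exp (Real.pi * I * (2 * m + 1) / M *
        ((ε + q.2) * (ε + q.1) * τ + (ε + q.1) * z₂ + (ε + q.2) * z₁)) =
      exp (Real.pi * I * (2 * m + 1) / M *
        ((ε + q.1) * (ε + q.2) * τ + (ε + q.2) * z₁ + (ε + q.1) * z₂)) := by
    congr 1
    ring
  simp only [hsq, PsiTilde, ofReal_add, ofReal_intCast]
  rw [hsq2, hexp3, hexp4, ← hexp2, ← hexp1,
    PhiTilde_eq_poincare m hτM _ (hterm q hq).1 (hterm q hq).2]
  ring

end OspB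

end

theorem theorem5p7 (M m : ℕ) (hM : 1 ≤ M) (hgcd : Nat.gcd M (4 * m + 2) = 1)
    (ε ε' : ℝ) (hε : ε = 0 ∨ ε = 1 / 2) (hε' : ε' = 0 ∨ ε' = 1 / 2)
    (j k : ℝ) (hjk : (j, k) ∈ OspB.Omega M ε')
    (τ z₁ z₂ t : ℂ) (hτ : 0 < τ.im) :
    ((∀ p ∈ OspB.Omega M ε, OspB.PsiRegular M ε' p.1 p.2 τ z₁ z₂) →
      OspB.PsiTilde M m ε j k ε' (-1 / τ) (z₁ / τ) (z₂ / τ) (t - z₁ * z₂ / τ) =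
        τ / M * OspB.signPow (ε' + j) *
          ∑ p ∈ (OspB.Omega_finite M ε).toFinset,
            OspB.signPow (p.1 - ε) *
              Complex.exp (-(2 * Real.pi * Complex.I * (2 * m + 1) / (2 * M)) *
                (p.1 * k + p.2 * j)) *
              OspB.PsiTilde M m ε' p.1 p.2 ε τ z₁ z₂ t) ∧
    (OspB.PsiRegular M ε j k (τ + 1) z₁ z₂ →
      OspB.PsiTilde M m ε j k ε' (τ + 1) z₁ z₂ t =
        OspB.signPow (j - ε' + 4 * ε * ε') *
          Complex.exp (2 * Real.pi * Complex.I * (2 * m + 1) / (2 * M) * (j * k)) *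
          OspB.PsiTilde M m |ε - ε'| j k ε' τ z₁ z₂ t) := by
  have hM2 : Odd M := by
    rw [← Nat.not_even_iff_odd]
    intro h
    have h2 : 2 ∣ Nat.gcd M (4 * m + 2) := Nat.dvd_gcd h.two_dvd ⟨2 * m + 1, by ring⟩
    omega
  have hs : Nat.Coprime (2 * m + 1) M :=
    Nat.Coprime.symm (Nat.Coprime.coprime_dvd_right ⟨2, by ring⟩ hgcd)
  exact ⟨fun hreg => OspB.PsiTilde_neg_inv hM2 hs hε hε' hjk t hτ hreg,
    fun hreg => OspB.PsiTilde_add_one hM2 hε hε' hjk t hτ hreg⟩
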